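/- Let $d\ge 1$, $\boldsymbol\nu\in\mathbb{N}_0^d$ and $[a,b]\subset\mathbb{R}$. Setting. For $i=0,\dots,d$ let $\rho_i:\mathbb{R}\to[0,\infty)$ be a probability density with support $\mathbb{R}$ and let $\psi_i:\mathbb{R}\to(0,\infty)$ be integrable; let $\gamma_{\mathfrak u}>0$ for $\mathfrak u\subseteq\{0,\dots,d\}$, with $\gamma_\emptyset=1$. Write points of $\mathbb{R}^{d+1}$ as $(y_0,\boldsymbol y)$ with $\boldsymbol y=(y_1,\dots,y_d)$, let $D^i=\partial/\partial y_i$, and for a multi-index $\boldsymbol\eta$ let $|\boldsymbol\eta|=\sum_i\eta_i$, $D^{\boldsymbol\eta}=\prod_i(D^i)^{\eta_i}$, $\gamma_{\boldsymbol\eta}=\gamma_{\{i:\eta_i\neq0\}}$, $\boldsymbol\psi_{\boldsymbol\eta}=\prod_{\eta_i\ne0}\psi_i(y_i)$, $\boldsymbol\rho_{-\boldsymbol\eta}=\prod_{\eta_i=0}\rho_i(y_i)$, where $i$ ranges over $\{1,\dots,d\}$ for $d$-variate functions and over $\{0,\dots,d\}$ for $(d+1)$-variate functions. Multi-indices are compared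 componentwise. $C^{\boldsymbol\nu}(\mathbb{R}^d)$ is the space of functions whose mixed derivatives $D^{\boldsymbol\eta}g$, $\boldsymbol\eta\le\boldsymbol\nu$, are all continuous, and $\mathcal H^{\boldsymbol\nu}_d$ is the space of locally integrable functions $g$ on $\mathbb{R}^d$ with finite norm $$\|g\|^2_{\mathcal H^{\boldsymbol\nu}_d}=\sum_{\boldsymbol\eta\le\boldsymbol\nu}\frac1{\gamma_{\boldsymbol\eta}}\int_{\mathbb{R}^d}|D^{\boldsymbol\eta}g|^2\,\boldsymbol\psi_{\boldsymbol\eta}\,\boldsymbol\rho_{-\boldsymbol\eta}\,\mathrm d\boldsymbol y$$ (weak derivatives); $\mathcal H_{d+1}$ and $C(\mathbb{R}^{d+1})$ with multi-indices in $\mathbb{N}_0^{d+1}$ are defined analogously on $\mathbb{R}^{d+1}$. Assumption 1. $\phi:\mathbb{R}^{d+1}\to\mathbb{R}$ satisfies $D^0\phi>0$ everywhere; $\phi(y_0,\boldsymbol y)\to\infty$ as $y_0\to\infty$ for each $\boldsymbol y$; $\phi\in\mathcal H^{(|\boldsymbol\nu|+1,\boldsymbol\nu)}_{d+1}\cap C^{(|\boldsymbol\nu|+1,\boldsymbol\nu)}(\mathbb{R}^{d+1})$;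 and $\rho_0\in C^{|\boldsymbol\nu|}(\mathbb{R})$. Let $U_t=\{\boldsymbol y\in\mathbb{R}^d:\phi(y_0,\boldsymbol y)=t\text{ for some }y_0\in\mathbb{R}\}$ and, for $\boldsymbol y\in U_t$, let $\xi=\xi(t,\boldsymbol y)$ be the unique real number with $\phi(\xi,\boldsymbol y)=t$. Assumption 2 with $q=1$. For every $\boldsymbol\eta\le\boldsymbol\nu$ there is a constant $B_{1,\boldsymbol\eta}<\infty$ such that every function $$h(t,\boldsymbol y)=\frac{(-1)^r\rho_0^{(\beta)}(\xi)\prod_{\ell=1}^rD^{\boldsymbol\alpha_\ell}\phi(\xi,\boldsymbol y)}{[D^0\phi(\xi,\boldsymbol y)]^{r+1}},\qquad t\in[a,b],\ \boldsymbol y\in U_t,$$ with $r,\beta\in\mathbb{N}_0$ and $\boldsymbol\alpha_\ell\in\mathbb{N}_0^{d+1}\setminus\{\boldsymbol e_0,\boldsymbol 0\}$ satisfying $r\le2|\boldsymbol\eta|$, $\alpha_{\ell,0}\le|\boldsymbol\eta|+1$, $\beta\le|\boldsymbol\eta|$ and $\beta\boldsymbol e_0+\sum_{\ell=1}^r\boldsymbol\alpha_\ell=(r,\boldsymbol\eta)$,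 where $\boldsymbol e_0=(1,0,\dots,0)$, satisfies, for all $t\in[a,b]$, $h(t,\boldsymbol y)\to0$ as $\boldsymbol y\in U_t$ tends to any point of $\partial U_t$, and $$\sup_{t\in[a,b]}\int_{U_t}|h(t,\boldsymbol y)|^2\,\boldsymbol\psi_{\boldsymbol\eta}\,\boldsymbol\rho_{-\boldsymbol\eta}\,\mathrm d\boldsymbol y\le B_{1,\boldsymbol\eta}.$$ Theorem. Under these assumptions, for every $t\in[a,b]$ and $\boldsymbol y\in\mathbb{R}^d$ the distribution $\delta(t-\phi(\cdot,\boldsymbol y))$ on $\mathbb{R}$ (the limit, tested against continuous functions with compact support, of $\delta_\varepsilon(t-\phi(\cdot,\boldsymbol y))$ as $\varepsilon\to0^+$, where $\delta_\varepsilon(x)=\varepsilon^{-1}\kappa(x/\varepsilon)$ with any smooth compactly supported $\kappa\ge0$ with $\int\kappa=1$) is well defined as a locally finite measure, and its preintegral $P_0g_t(\boldsymbol y)=\int_{\mathbb{R}}\delta(t-\phi(y_0,\boldsymbol y))\,\rho_0(y_0)\,\mathrm dy_0$ equals $\rho_0(\xi(t,\boldsymbol y))/D^0\phi(\xi(t,\boldsymbol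 y),\boldsymbol y)$ if $\boldsymbol y\in U_t$ and $0$ if $\boldsymbol y\notin U_t$. Moreover $P_0g_t\in\mathcal H^{\boldsymbol\nu}_d\cap C^{\boldsymbol\nu}(\mathbb{R}^d)$ for every $t\in[a,b]$, and $$\sup_{t\in[a,b]}\|P_0g_t\|_{\mathcal H^{\boldsymbol\nu}_d}\le\Bigg(\sum_{\boldsymbol\eta\le\boldsymbol\nu}\frac{\big(8^{|\boldsymbol\eta|}|\boldsymbol\eta|!\big)^2B_{1,\boldsymbol\eta}}{\gamma_{\boldsymbol\eta}}\Bigg)^{1/2}<\infty.$$ -/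

import Mathlib

open MeasureTheory Filter Topology
open scoped NNReal ENNReal

noncomputable section

namespace Preint

/-! ### Mixed partial derivatives -/

/-- The order `|η| = ∑ i, η i` of a multi-index. -/
def order {n : ℕ} (η : Fin n → ℕ) : ℕ := ∑ i, η i

/-- The first-order partial derivative `D^i g = ∂g/∂y_i`. -/
def partialD {n : ℕ} (i : Fin n) (g : (Fin n → ℝ) → ℝ) : (Fin n → ℝ) → ℝ :=
  fun y => deriv (fun s : ℝ => g (Function.update y i s)) (y i)

/-- The mixed partial derivative `D^η g = ∂_0^{η_0} ⋯ ∂_{n-1}^{η_{n-1}} g`. -/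
def mixedD {n : ℕ} (η : Fin n → ℕ) (g : (Fin n → ℝ) → ℝ) : (Fin n → ℝ) → ℝ :=
  (List.finRange n).foldr (fun i f => (partialD i)^[η i] f) g

/-- `g ∈ C^ν(ℝⁿ)`: for every `η ≤ ν` the mixed derivative `D^η g` exists and is continuous.
Existence is expressed by: as long as `η + e_i ≤ ν`, the function `D^η g` is differentiable in the
variable `y_i` with derivative `D^{η + e_i} g` (by the symmetry of continuous mixed derivatives,
the order of differentiation is immaterial). -/
def ContMixed {n : ℕ} (ν : Fin n → ℕ) (g : (Fin n → ℝ) → ℝ) : Prop :=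
  ∀ η : Fin n → ℕ, η ≤ ν →
    Continuous (mixedD η g) ∧
    ∀ i : Fin n, η + Pi.single i 1 ≤ ν → ∀ y : Fin n → ℝ,
      HasDerivAt (fun s : ℝ => mixedD η g (Function.update y i s))
        (mixedD (η + Pi.single i 1) g y) (y i)

/-! ### Sobolev spaces of dominating mixed smoothness -/

/-- `w` is the `η`-th weak derivative of `g` on `ℝⁿ`. -/
def IsWeakDeriv {n : ℕ} (η : Fin n → ℕ) (g w : (Fin n → ℝ) → ℝ) : Prop :=
  LocallyIntegrable w volume ∧
  ∀ v : (Fin n → ℝ) → ℝ, ContDiff ℝ (⊤ : ℕ∞) v → HasCompactSupport v →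
    ∫ y, w y * v y = (-1) ^ order η * ∫ y, g y * mixedD η v y

/-- The support of a multi-index. -/
def supp {n : ℕ} (η : Fin n → ℕ) : Finset (Fin n) := Finset.univ.filter (fun i => η i ≠ 0)

/-- The weight `ψ_η(y_η) ρ_{-η}(y_{-η}) = ∏_{η_i ≠ 0} ψ_i(y_i) ∏_{η_i = 0} ρ_i(y_i)`. -/
def weight {n : ℕ} (ρ ψ : Fin n → ℝ → ℝ) (η : Fin n → ℕ) (y : Fin n → ℝ) : ℝ :=
  (∏ i ∈ supp η, ψ i (y i)) * ∏ i ∈ (supp η)ᶜ, ρ i (y i)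

/-- `∫ |D^η g|² ψ_η ρ_{-η} dy`, where `D^η g` is the weak derivative. All weak derivatives of order
`η` of `g` agree almost everywhere, so the infimum runs over a single value; it is `⊤` when the
weak derivative does not exist as a function. -/
def energy {n : ℕ} (ρ ψ : Fin n → ℝ → ℝ) (η : Fin n → ℕ) (g : (Fin n → ℝ) → ℝ) : ℝ≥0∞ :=
  ⨅ (w : (Fin n → ℝ) → ℝ) (_ : IsWeakDeriv η g w),
    ∫⁻ y, ENNReal.ofReal (|w y| ^ 2 * weight ρ ψ η y)

/-- The norm of `H^ν`, with value `⊤` when it is not finite. -/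
def sobolevNorm {n : ℕ} (ρ ψ : Fin n → ℝ → ℝ) (γ : Finset (Fin n) → ℝ) (ν : Fin n → ℕ)
    (g : (Fin n → ℝ) → ℝ) : ℝ≥0∞ :=
  (∑ η ∈ Finset.Iic ν, ENNReal.ofReal (1 / γ (supp η)) * energy ρ ψ η g) ^ (1 / 2 : ℝ)

/-- `g ∈ H^ν`. -/
def MemSobolev {n : ℕ} (ρ ψ : Fin n → ℝ → ℝ) (γ : Finset (Fin n) → ℝ) (ν : Fin n → ℕ)
    (g : (Fin n → ℝ) → ℝ) : Prop :=
  LocallyIntegrable g volume ∧ sobolevNorm ρ ψ γ ν g < ⊤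

/-- The standing requirements on the densities `ρ_i`, the weight functions `ψ_i` and the weight
parameters `γ_u`. -/
structure IsSetting {n : ℕ} (ρ ψ : Fin n → ℝ → ℝ) (γ : Finset (Fin n) → ℝ) : Prop where
  density_measurable : ∀ i, Measurable (ρ i)
  density_nonneg : ∀ i x, 0 ≤ ρ i x
  density_integrable : ∀ i, Integrable (ρ i) volume
  density_integral : ∀ i, ∫ x, ρ i x = 1
  density_support : ∀ i, tsupport (ρ i) = Set.univ
  weight_pos : ∀ i x, 0 < ψ i x
  weight_integrable : ∀ i, Integrable (ψ i) volume
  param_pos : ∀ u, 0 < γ u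
  param_empty : γ ∅ = 1

/-- Restriction of a family indexed by `{0, …, d}` to the indices `{1, …, d}`. -/
def tailFam {d : ℕ} (ρ : Fin (d + 1) → ℝ → ℝ) : Fin d → ℝ → ℝ := fun i => ρ i.succ

/-- Restriction of the weight parameters to the subsets of `{1, …, d}`. -/
def tailParam {d : ℕ} (γ : Finset (Fin (d + 1)) → ℝ) : Finset (Fin d) → ℝ :=
  fun u => γ (u.map (Fin.succEmb d))

/-! ### The assumptions on `φ` -/

/-- The point `(s, y) ∈ ℝ^{d+1}`. -/
def pt {d : ℕ} (s : ℝ) (y : Fin d → ℝ) : Fin (d + 1) → ℝ := Fin.cons s y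

/-- The multi-index `(k, η) ∈ ℕ^{d+1}`. -/
def idx {d : ℕ} (k : ℕ) (η : Fin d → ℕ) : Fin (d + 1) → ℕ := Fin.cons k η

/-- Monotonicity, growth and smoothness of `φ`, and smoothness of `ρ_0`. -/
structure Smooth {d : ℕ} (ρ ψ : Fin (d + 1) → ℝ → ℝ) (γ : Finset (Fin (d + 1)) → ℝ)
    (ν : Fin d → ℕ) (φ : (Fin (d + 1) → ℝ) → ℝ) : Prop where
  mono : ∀ (s : ℝ) (y : Fin d → ℝ), 0 < partialD 0 φ (pt s y)
  growth : ∀ y : Fin d → ℝ, Tendsto (fun s : ℝ => φ (pt s y)) atTop atTop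
  mem_sobolev : MemSobolev ρ ψ γ (idx (order ν + 1) ν) φ
  cont_mixed : ContMixed (idx (order ν + 1) ν) φ
  density_smooth : ContDiff ℝ (order ν : ℕ) (ρ 0)

/-- `U_t = {y : φ(y_0, y) = t for some y_0}`. -/
def U {d : ℕ} (φ : (Fin (d + 1) → ℝ) → ℝ) (t : ℝ) : Set (Fin d → ℝ) :=
  {y | ∃ s : ℝ, φ (pt s y) = t}

open Classical in
/-- For `y ∈ U_t`, a solution `s = ξ(t, y)` of `φ(s, y) = t` (unique when `φ` is strictly increasing
in its first variable); the value outside `U_t` is irrelevant. -/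
def xi {d : ℕ} (φ : (Fin (d + 1) → ℝ) → ℝ) (t : ℝ) (y : Fin d → ℝ) : ℝ :=
  if h : ∃ s : ℝ, φ (pt s y) = t then h.choose else 0

/-- The function `h_{q,η,(r,α,β)}(t, y)`. -/
def hFun {d : ℕ} (ρ₀ : ℝ → ℝ) (φ : (Fin (d + 1) → ℝ) → ℝ) (q r : ℕ)
    (α : Fin r → Fin (d + 1) → ℕ) (β : ℕ) (t : ℝ) (y : Fin d → ℝ) : ℝ :=
  ((-1) ^ r * iteratedDeriv β ρ₀ (xi φ t y) * ∏ l, mixedD (α l) φ (pt (xi φ t y) y)) /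
    partialD 0 φ (pt (xi φ t y) y) ^ (r + q)

/-- The admissible parameters `(r, α, β)` for `h_{q,η}`:
`r ≤ 2|η| + q - 1`, `α_l ∉ {e_0, 0}`, `α_{l,0} ≤ |η| + q`, `β ≤ |η| + q - 1` and
`β e_0 + ∑ α_l = (r + q - 1, η)`. -/
structure Admissible {d : ℕ} (q : ℕ) (η : Fin d → ℕ) (r : ℕ) (α : Fin r → Fin (d + 1) → ℕ)
    (β : ℕ) : Prop where
  r_le : r + 1 ≤ 2 * order η + q
  ne_zero : ∀ l, α l ≠ 0
  ne_single : ∀ l, α l ≠ Pi.single 0 1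
  zero_le : ∀ l, α l 0 ≤ order η + q
  beta_le : β + 1 ≤ order η + q
  sum_zero : β + ∑ l, α l 0 + 1 = r + q
  sum_succ : ∀ i : Fin d, ∑ l, α l i.succ = η i

/-- All functions `h_{q,η}` tend to `0` at the boundary of `U_t` and have weighted second moments
over `U_t` bounded by `B`, for all `t ∈ [a, b]`. -/
def Controlled {d : ℕ} (ρ ψ : Fin (d + 1) → ℝ → ℝ) (φ : (Fin (d + 1) → ℝ) → ℝ) (a b : ℝ)
    (q : ℕ) (η : Fin d → ℕ) (B : ℝ≥0) : Prop :=
  ∀ (r : ℕ) (α : Fin r → Fin (d + 1) → ℕ) (β : ℕ), Admissible q η r α β →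
    (∀ t ∈ Set.Icc a b, ∀ z ∈ frontier (U φ t),
      Tendsto (hFun (ρ 0) φ q r α β t) (𝓝[U φ t] z) (𝓝 0)) ∧
    (⨆ t ∈ Set.Icc a b, ∫⁻ y in U φ t,
      ENNReal.ofReal (|hFun (ρ 0) φ q r α β t y| ^ 2 * weight (tailFam ρ) (tailFam ψ) η y))
        ≤ (B : ℝ≥0∞)

/-! ### The Dirac distribution composed with a function -/

/-- The locally finite measure `μ` on `ℝ` is the distribution `δ(t - f(·))`: for every mollifier
`κ`, with `δ_ε(x) = κ(x/ε)/ε`, the functions `δ_ε(t - f(·))` converge to `μ` when tested against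
continuous functions of compact support. -/
def IsDiracComp (f : ℝ → ℝ) (t : ℝ) (μ : Measure ℝ) : Prop :=
  IsFiniteMeasureOnCompacts μ ∧
  ∀ κ : ℝ → ℝ, ContDiff ℝ (⊤ : ℕ∞) κ → HasCompactSupport κ → (∀ x, 0 ≤ κ x) → ∫ x, κ x = 1 →
    ∀ v : ℝ → ℝ, Continuous v → HasCompactSupport v →
      Tendsto (fun ε : ℝ => ∫ s, ε⁻¹ * κ ((t - f s) / ε) * v s) (𝓝[>] 0) (𝓝 (∫ s, v s ∂μ))

open Classical in
/-- The distribution `δ(t - f(·))` (a locally finite measure, unique if it exists). -/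
def diracComp (f : ℝ → ℝ) (t : ℝ) : Measure ℝ :=
  if h : ∃ μ : Measure ℝ, IsDiracComp f t μ then h.choose else 0

/-- The preintegrated Dirac distribution
`P_0 g_t(y) = ∫ δ(t - φ(y_0, y)) ρ_0(y_0) dy_0`. -/
def preintDirac {d : ℕ} (ρ₀ : ℝ → ℝ) (φ : (Fin (d + 1) → ℝ) → ℝ) (t : ℝ) (y : Fin d → ℝ) : ℝ :=
  ∫ s, ρ₀ s ∂(diracComp (fun s => φ (pt s y)) t)

end Preint

end

/-! For fixed `y` the map `f = φ(·, y)` is C¹ with positive derivative. If `t` is a value of `f`,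
the substitution `u = f s` turns the mollified functions into an approximate identity, and the limit
is the point mass at `ξ` with weight `1 / f' ξ` (`isDiracComp_smul_dirac`). If `t` is not a value,
growth at `+∞` forces `f > t`, and the mollified functions eventually vanish on each compact set
(`isDiracComp_zero`). This gives the formula for the preintegral.

On the open set `U_t` the implicit function satisfies `D^i ξ = -D^i φ / D^0 φ`. Differentiating a
function `h` in `y_i` therefore yields a sum of functions of the same shape
(`Term.hasDerivAt_eval`), whose parameters remain admissible (`Term.IsGood.of_mem_diff`). A function
with `r` factors produces `4r + 3` terms and `r` grows by at most 2 per derivative, so `k`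
derivatives produce at most `8^k k!` terms (`Term.length_terms_le`).

Each `h` tends to 0 at the boundary of `U_t`, so these sums, extended by zero, are continuous on the
whole space. A mean value argument shows that the extensions are still partial derivatives of one
another across the boundary (`hasPartial_of_zero_off`), which gives `isDerivFamily_preintDeriv` and
hence the classical smoothness. Integration by parts makes the classical derivatives weak ones, and
Cauchy–Schwarz over at most `8^k k!` terms gives the constant in the norm bound.

Membership in `C^ν` does not make the mixed derivatives Fréchet differentiable. Symmetry of
derivatives, the chain rule and implicit differentiation are therefore proved along coordinate
lines. Iterated derivatives are indexed by words, so that a new derivative can be put in front;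
permuted words give the same function (`IsDerivFamily.eq_of_perm`). -/

noncomputable section

namespace Preint

/-! ### Partial derivatives along coordinate lines -/

/-- `g'` is the partial derivative of `g` in the variable `y_i`, everywhere. -/
def HasPartial {n : ℕ} (i : Fin n) (g g' : (Fin n → ℝ) → ℝ) : Prop :=
  ∀ y, HasDerivAt (fun s : ℝ => g (Function.update y i s)) (g' y) (y i)

theorem tendsto_of_mem_uIcc {ι : Type*} {l : Filter ι} {θ p : ι → ℝ} {x : ℝ}
    (hθ : ∀ s, θ s ∈ Set.uIcc x (p s)) (hp : Tendsto p l (𝓝 x)) : Tendsto θ l (𝓝 x) := by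
  rw [tendsto_iff_dist_tendsto_zero] at hp ⊢
  refine squeeze_zero (fun _ => dist_nonneg) (fun s => ?_) hp
  simpa [Real.dist_eq] using Set.abs_sub_left_of_mem_uIcc (hθ s)

/-- Mean value theorem without any order on the endpoints, which may coincide; the closed interval
makes room for the degenerate case. -/
theorem exists_eq_deriv_mul_sub {f f' : ℝ → ℝ} (hf : ∀ x, HasDerivAt f (f' x) x) (s s' : ℝ) :
    ∃ θ ∈ Set.uIcc s s', f s' - f s = f' θ * (s' - s) := by
  have key : ∀ p q : ℝ, p < q → ∃ θ ∈ Set.uIcc p q, f q - f p = f' θ * (q - p) := by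
    intro p q hpq
    obtain ⟨c, hc, h⟩ := exists_hasDerivAt_eq_slope f f' hpq
      (fun x _ => (hf x).continuousAt.continuousWithinAt) (fun x _ => hf x)
    refine ⟨c, ?_, ?_⟩
    · rw [Set.uIcc_of_le hpq.le]; exact Set.Ioo_subset_Icc_self hc
    · rw [h, div_mul_cancel₀ _ (sub_ne_zero.2 hpq.ne')]
  rcases lt_trichotomy s s' with h | h | h
  · exact key s s' h
  · exact ⟨s, by simp, by simp [h]⟩
  · obtain ⟨θ, hθ, e⟩ := key s' s h
    exact ⟨θ, by rwa [Set.uIcc_comm], by linarith⟩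

namespace HasPartial

variable {n : ℕ} {i j : Fin n} {g g' g'' : (Fin n → ℝ) → ℝ}

theorem hasDerivAt_update (h : HasPartial i g g') (y : Fin n → ℝ) (s : ℝ) :
    HasDerivAt (fun s : ℝ => g (Function.update y i s)) (g' (Function.update y i s)) s := by
  simpa using h (Function.update y i s)

theorem eq_partialD (h : HasPartial i g g') : partialD i g = g' :=
  funext fun y => (h y).deriv

theorem unique (h : HasPartial i g g') (h' : HasPartial i g g'') : g' = g'' := by
  rw [← h.eq_partialD, h'.eq_partialD]

theorem exists_sub_eq (h : HasPartial i g g') (y : Fin n → ℝ) (s s' : ℝ) :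
    ∃ θ ∈ Set.uIcc s s', g (Function.update y i s') - g (Function.update y i s) =
      g' (Function.update y i θ) * (s' - s) :=
  exists_eq_deriv_mul_sub (h.hasDerivAt_update y) s s'

/-- Apply the mean value theorem in `y_i` to the increment of `f` in `y_j`, then in `y_j` to `a`.
Read in both orders, the same second difference gives the symmetry of mixed derivatives. -/
theorem exists_second_difference {f a c : (Fin n → ℝ) → ℝ} (hij : i ≠ j) (ha : HasPartial i f a)
    (hc : HasPartial j a c) (y : Fin n → ℝ) (h : ℝ) :
    ∃ θ ∈ Set.uIcc (y i) (y i + h), ∃ τ ∈ Set.uIcc (y j) (y j + h),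
      (f (Function.update (Function.update y i (y i + h)) j (y j + h)) -
        f (Function.update (Function.update y i (y i + h)) j (y j))) -
      (f (Function.update (Function.update y i (y i)) j (y j + h)) -
        f (Function.update (Function.update y i (y i)) j (y j))) =
      c (Function.update (Function.update y i θ) j τ) * h * h := by
  have hd : ∀ s, HasDerivAt (fun s => f (Function.update (Function.update y i s) j (y j + h)) -
      f (Function.update (Function.update y i s) j (y j)))
      (a (Function.update (Function.update y i s) j (y j + h)) -
        a (Function.update (Function.update y i s) j (y j))) s := by
    intro s
    simp only [fun s u => Function.update_comm hij s u y]
    exact (ha.hasDerivAt_update _ s).sub (ha.hasDerivAt_update _ s)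
  obtain ⟨θ, hθ, e⟩ := exists_eq_deriv_mul_sub hd (y i) (y i + h)
  obtain ⟨τ, hτ, e'⟩ := hc.exists_sub_eq (Function.update y i θ) (y j) (y j + h)
  refine ⟨θ, hθ, τ, hτ, ?_⟩
  rw [e, e']; ring

/-- Symmetry of continuous mixed second derivatives. -/
theorem swap {f a b c c' : (Fin n → ℝ) → ℝ} (ha : HasPartial i f a) (hb : HasPartial j f b)
    (hc : HasPartial j a c) (hc' : HasPartial i b c') (cc : Continuous c) (cc' : Continuous c') :
    c = c' := by
  rcases eq_or_ne i j with rfl | hij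
  · obtain rfl := ha.unique hb
    exact hc.unique hc'
  funext y
  choose θ hθ τ hτ e using exists_second_difference hij ha hc y
  choose τ' hτ' θ' hθ' e' using exists_second_difference hij.symm hb hc' y
  have hp : ∀ x : ℝ, Tendsto (fun h => x + h) (𝓝[≠] (0 : ℝ)) (𝓝 x) := fun x => by
    have : Tendsto (fun h => x + h) (𝓝 (0 : ℝ)) (𝓝 (x + 0)) :=
      (continuous_const.add continuous_id).tendsto 0
    rw [add_zero] at this
    exact this.mono_left nhdsWithin_le_nhds
  have lim : ∀ {k : (Fin n → ℝ) → ℝ} {p q : ℝ → ℝ} {u v : Fin n}, Continuous k →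
      (∀ h, p h ∈ Set.uIcc (y u) (y u + h)) → (∀ h, q h ∈ Set.uIcc (y v) (y v + h)) →
      Tendsto (fun h => k (Function.update (Function.update y u (p h)) v (q h))) (𝓝[≠] (0 : ℝ))
        (𝓝 (k y)) := by
    intro k p q u v hk h1 h2
    have t1 := tendsto_of_mem_uIcc h1 (hp _)
    have t2 := tendsto_of_mem_uIcc h2 (hp _)
    have h3 : Tendsto (fun h => Function.update (Function.update y u (p h)) v (q h))
        (𝓝[≠] (0 : ℝ)) (𝓝 (Function.update (Function.update y u (y u)) v (y v))) :=
      (tendsto_const_nhds.update u t1).update v t2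
    simp only [Function.update_eq_self] at h3
    exact (hk.tendsto y).comp h3
  -- For `h ≠ 0` both intermediate values equal the second difference divided by `h²`; as `h → 0`
  -- they converge to `c y` and `c' y`.
  refine tendsto_nhds_unique (lim cc hθ hτ) ((lim cc' hτ' hθ').congr' ?_)
  filter_upwards [self_mem_nhdsWithin] with h hh
  have hh : h ≠ 0 := hh
  have e1 := e h
  have e2 := e' h
  simp only [fun s u => Function.update_comm hij s u y] at e1
  have : c' (Function.update (Function.update y j (τ' h)) i (θ' h)) * (h * h) =
      c (Function.update (Function.update y i (θ h)) j (τ h)) * (h * h) := by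
    rw [Function.update_comm hij]
    linarith
  exact mul_right_cancel₀ (mul_ne_zero hh hh) this

end HasPartial

/-! ### Families of iterated derivatives indexed by words -/

/-- The multi-index that counts the letters of a word. -/
def wordIdx {n : ℕ} (w : List (Fin n)) : Fin n → ℕ := fun i => w.count i

/-- The word `0^{η_0} 1^{η_1} ⋯`. -/
def word {n : ℕ} (η : Fin n → ℕ) : List (Fin n) :=
  (List.finRange n).flatMap fun i => List.replicate (η i) i

section Words

variable {n : ℕ}

theorem wordIdx_cons (i : Fin n) (w : List (Fin n)) :
    wordIdx (i :: w) = wordIdx w + Pi.single i 1 := by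
  funext j
  rcases eq_or_ne i j with rfl | h
  · simp [wordIdx]
  · simp [wordIdx, h, h.symm]

theorem wordIdx_le_cons (i : Fin n) (w : List (Fin n)) : wordIdx w ≤ wordIdx (i :: w) := by
  rw [wordIdx_cons]; exact le_self_add

theorem wordIdx_perm {w w' : List (Fin n)} (h : w.Perm w') : wordIdx w = wordIdx w' :=
  funext fun i => h.count_eq i

theorem wordIdx_word (η : Fin n → ℕ) : wordIdx (word η) = η := by
  funext j
  have : ∀ L : List (Fin n), L.Nodup →
      (L.flatMap fun i => List.replicate (η i) i).count j = if j ∈ L then η j else 0 := by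
    intro L
    induction L with
    | nil => simp
    | cons k L ih =>
      intro h
      rw [List.nodup_cons] at h
      rw [List.flatMap_cons, List.count_append, ih h.2, List.count_replicate]
      rcases eq_or_ne k j with rfl | hk
      · simp [h.1]
      · simp [hk, hk.symm]
  rw [wordIdx, word, this _ (List.nodup_finRange n), if_pos (List.mem_finRange j)]

theorem perm_of_wordIdx_eq {w w' : List (Fin n)} (h : wordIdx w = wordIdx w') : w.Perm w' :=
  List.perm_iff_count.2 fun i => congrFun h i

theorem order_wordIdx (w : List (Fin n)) : order (wordIdx w) = w.length := by
  have := Multiset.sum_count_eq_card (s := Finset.univ) (m := (w : Multiset (Fin n)))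
    fun a _ => Finset.mem_univ a
  simpa [order, wordIdx] using this

/-- A family of functions indexed by words, consisting of the iterated continuous partial
derivatives of its member at the empty word, up to the multi-index `ν`. -/
structure IsDerivFamily (ν : Fin n → ℕ) (G : List (Fin n) → (Fin n → ℝ) → ℝ) : Prop where
  continuous : ∀ w, wordIdx w ≤ ν → Continuous (G w)
  hasPartial : ∀ i w, wordIdx (i :: w) ≤ ν → HasPartial i (G w) (G (i :: w))

namespace IsDerivFamily

variable {ν : Fin n → ℕ} {G : List (Fin n) → (Fin n → ℝ) → ℝ}

/-- A permutation is a product of adjacent transpositions, and each of these is one use of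
`HasPartial.swap`. All words involved have the same multi-index, so the derivatives needed exist and
are continuous. -/
theorem eq_of_perm (hG : IsDerivFamily ν G) {w w' : List (Fin n)} (h : w.Perm w')
    (hw : wordIdx w ≤ ν) : G w = G w' := by
  induction h with
  | nil => rfl
  | cons i p ih =>
    have h1 := hG.hasPartial i _ hw
    have h2 := hG.hasPartial i _ ((wordIdx_perm (p.cons i)) ▸ hw)
    rw [← ih ((wordIdx_le_cons _ _).trans hw)] at h2
    exact h1.unique h2
  | swap i j w =>
    have hw' := (wordIdx_perm (List.Perm.swap i j w)) ▸ hw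
    exact HasPartial.swap (hG.hasPartial i w ((wordIdx_le_cons _ _).trans hw))
      (hG.hasPartial j w ((wordIdx_le_cons _ _).trans hw')) (hG.hasPartial j _ hw)
      (hG.hasPartial i _ hw') (hG.continuous _ hw) (hG.continuous _ hw')
  | trans p q ih ih' => exact (ih hw).trans (ih' ((wordIdx_perm p) ▸ hw))

theorem iterate_partialD (hG : IsDerivFamily ν G) (i : Fin n) (w : List (Fin n)) (k : ℕ)
    (hw : wordIdx (List.replicate k i ++ w) ≤ ν) :
    (partialD i)^[k] (G w) = G (List.replicate k i ++ w) := by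
  induction k with
  | zero => rfl
  | succ k ih =>
    rw [List.replicate_succ, List.cons_append] at hw ⊢
    rw [Function.iterate_succ_apply', ih ((wordIdx_le_cons _ _).trans hw)]
    exact (hG.hasPartial i _ hw).eq_partialD

theorem mixedD_eq_word (hG : IsDerivFamily ν G) {η : Fin n → ℕ} (hη : η ≤ ν) :
    mixedD η (G []) = G (word η) := by
  have key : ∀ L : List (Fin n), wordIdx (L.flatMap fun i => List.replicate (η i) i) ≤ ν →
      L.foldr (fun i f => (partialD i)^[η i] f) (G []) =
        G (L.flatMap fun i => List.replicate (η i) i) := by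
    intro L
    induction L with
    | nil => intro _; rfl
    | cons k L ih =>
      intro h
      rw [List.flatMap_cons] at h ⊢
      rw [List.foldr_cons, ih, hG.iterate_partialD k _ _ h]
      refine le_trans (fun j => ?_) h
      simp [wordIdx]
  exact key _ (by rw [← word, wordIdx_word]; exact hη)

theorem mixedD_eq (hG : IsDerivFamily ν G) {w : List (Fin n)} (hw : wordIdx w ≤ ν) :
    mixedD (wordIdx w) (G []) = G w := by
  rw [hG.mixedD_eq_word hw]
  exact hG.eq_of_perm (perm_of_wordIdx_eq (wordIdx_word _)) (by rwa [wordIdx_word])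

theorem contMixed (hG : IsDerivFamily ν G) : ContMixed ν (G []) := by
  intro η hη
  have hw : wordIdx (word η) ≤ ν := by rwa [wordIdx_word]
  refine ⟨by rw [hG.mixedD_eq_word hη]; exact hG.continuous _ hw, fun i hi => ?_⟩
  have e : wordIdx (i :: word η) = η + Pi.single i 1 := by rw [wordIdx_cons, wordIdx_word]
  rw [← e, hG.mixedD_eq (by rwa [e]), hG.mixedD_eq_word hη]
  exact hG.hasPartial i _ (by rwa [e])

end IsDerivFamily

/-! ### Test functions and integration by parts -/

/-- Iterated partial derivatives along a word. -/
def wordD (w : List (Fin n)) (v : (Fin n → ℝ) → ℝ) : (Fin n → ℝ) → ℝ := w.foldr partialD v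

theorem hasPartial_fderiv {v : (Fin n → ℝ) → ℝ} (hv : Differentiable ℝ v) (i : Fin n) :
    HasPartial i v (fun y => fderiv ℝ v y (Pi.single i 1)) := by
  intro y
  have h : HasFDerivAt v (fderiv ℝ v y) (Function.update y i (y i)) := by
    simpa using (hv y).hasFDerivAt
  exact h.comp_hasDerivAt (y i) (hasDerivAt_update y i (y i))

theorem partialD_eq_fderiv {v : (Fin n → ℝ) → ℝ} (hv : Differentiable ℝ v) (i : Fin n) :
    partialD i v = fun y => fderiv ℝ v y (Pi.single i 1) :=
  (hasPartial_fderiv hv i).eq_partialD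

theorem contDiff_partialD {v : (Fin n → ℝ) → ℝ} (hv : ContDiff ℝ (⊤ : ℕ∞) v) (i : Fin n) :
    ContDiff ℝ (⊤ : ℕ∞) (partialD i v) := by
  rw [partialD_eq_fderiv (hv.differentiable (by simp))]
  exact (hv.fderiv_right (m := (⊤ : ℕ∞)) (by simp)).clm_apply contDiff_const

theorem hasCompactSupport_partialD {v : (Fin n → ℝ) → ℝ} (hv : ContDiff ℝ (⊤ : ℕ∞) v)
    (hc : HasCompactSupport v) (i : Fin n) : HasCompactSupport (partialD i v) := by
  rw [partialD_eq_fderiv (hv.differentiable (by simp))]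
  exact hc.fderiv_apply (𝕜 := ℝ) _

theorem contDiff_wordD {v : (Fin n → ℝ) → ℝ} (hv : ContDiff ℝ (⊤ : ℕ∞) v) (w : List (Fin n)) :
    ContDiff ℝ (⊤ : ℕ∞) (wordD w v) := by
  induction w with
  | nil => exact hv
  | cons i w ih => exact contDiff_partialD ih i

theorem isDerivFamily_wordD {v : (Fin n → ℝ) → ℝ} (hv : ContDiff ℝ (⊤ : ℕ∞) v)
    (ν : Fin n → ℕ) : IsDerivFamily ν (fun w => wordD w v) where
  continuous w _ := (contDiff_wordD hv w).continuous
  hasPartial i w _ := by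
    have h := (contDiff_wordD hv w).differentiable (by simp)
    have := hasPartial_fderiv h i
    rwa [← partialD_eq_fderiv h] at this

theorem mixedD_wordIdx {v : (Fin n → ℝ) → ℝ} (hv : ContDiff ℝ (⊤ : ℕ∞) v) (w : List (Fin n)) :
    mixedD (wordIdx w) v = wordD w v :=
  (isDerivFamily_wordD hv (wordIdx w)).mixedD_eq le_rfl

theorem HasPartial.hasLineDerivAt {i : Fin n} {g g' : (Fin n → ℝ) → ℝ} (h : HasPartial i g g')
    (y : Fin n → ℝ) : HasLineDerivAt ℝ g (g' y) y (Pi.single i 1) := by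
  have h1 : HasDerivAt (fun s : ℝ => g (Function.update y i s)) (g' y) (y i + 0) := by
    simpa using h y
  have h2 := HasDerivAt.comp_const_add (y i) 0 h1
  have e : (fun x : ℝ => g (Function.update y i (y i + x))) = fun t => g (y + t • Pi.single i 1) := by
    funext t
    congr 1
    funext j
    rcases eq_or_ne j i with rfl | hj
    · simp
    · simp [hj]
  unfold HasLineDerivAt
  rw [← e]
  exact h2

/-- Since `g` is differentiable only along one coordinate, the line-derivative form of integration
by parts is used. Compact support of `v` provides every integrability condition. -/
theorem integral_partial_mul {i : Fin n} {g g' v : (Fin n → ℝ) → ℝ} (h : HasPartial i g g')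
    (hg : Continuous g) (hg' : Continuous g') (hv : ContDiff ℝ (⊤ : ℕ∞) v)
    (hc : HasCompactSupport v) :
    ∫ y, g' y * v y = - ∫ y, g y * partialD i v y := by
  have hp : HasPartial i v (partialD i v) := by
    have hd := hv.differentiable (by simp)
    have := hasPartial_fderiv hd i
    rwa [← partialD_eq_fderiv hd] at this
  have hv' := (contDiff_partialD hv i).continuous
  have hc' := hasCompactSupport_partialD hv hc i
  have := integral_bilinear_hasLineDerivAt_right_eq_neg_left_of_integrable (μ := volume)
    (f := g) (f' := g') (g := v) (g' := partialD i v) (v := Pi.single i 1)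
    (B := ContinuousLinearMap.mul ℝ ℝ)
    ((hg'.mul hv.continuous).integrable_of_hasCompactSupport hc.mul_left)
    ((hg.mul hv').integrable_of_hasCompactSupport hc'.mul_left)
    ((hg.mul hv.continuous).integrable_of_hasCompactSupport hc.mul_left)
    (fun x _ => h.hasLineDerivAt x) (fun x _ => hp.hasLineDerivAt x)
  simp only [ContinuousLinearMap.mul_apply'] at this
  rw [this, neg_neg]

theorem IsDerivFamily.integral_mul {ν : Fin n → ℕ} {G : List (Fin n) → (Fin n → ℝ) → ℝ}
    (hG : IsDerivFamily ν G) (w : List (Fin n)) (hw : wordIdx w ≤ ν) :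
    ∀ v : (Fin n → ℝ) → ℝ, ContDiff ℝ (⊤ : ℕ∞) v → HasCompactSupport v →
      ∫ y, G w y * v y = (-1) ^ w.length * ∫ y, G [] y * wordD w v y := by
  induction w with
  | nil => intro v _ _; simp [wordD]
  | cons i w ih =>
    intro v hv hc
    have hw' := (wordIdx_le_cons i w).trans hw
    rw [integral_partial_mul (hG.hasPartial i w hw) (hG.continuous w hw') (hG.continuous _ hw) hv hc,
      ih hw' _ (contDiff_partialD hv i) (hasCompactSupport_partialD hv hc i)]
    -- Integration by parts puts the letter `i` innermost on `v`, while the word has it outermost;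
    -- symmetry for smooth `v` reconciles the two.
    have e : wordD (i :: w) v = wordD w (partialD i v) := by
      rw [← mixedD_wordIdx hv, wordIdx_perm (List.perm_append_singleton i w).symm,
        mixedD_wordIdx hv]
      simp [wordD]
    rw [e, List.length_cons, pow_succ]
    ring

theorem IsDerivFamily.isWeakDeriv {ν : Fin n → ℕ} {G : List (Fin n) → (Fin n → ℝ) → ℝ}
    (hG : IsDerivFamily ν G) {η : Fin n → ℕ} (hη : η ≤ ν) :
    IsWeakDeriv η (G []) (G (word η)) := by
  have hw : wordIdx (word η) ≤ ν := by rwa [wordIdx_word]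
  refine ⟨(hG.continuous _ hw).locallyIntegrable, fun v hv hc => ?_⟩
  rw [hG.integral_mul _ hw v hv hc, ← mixedD_wordIdx hv, wordIdx_word, ← order_wordIdx,
    wordIdx_word]

end Words


/-! ### The Dirac distribution composed with an increasing function -/

theorem exists_mollifier : ∃ κ : ℝ → ℝ, ContDiff ℝ (⊤ : ℕ∞) κ ∧ HasCompactSupport κ ∧
    (∀ x, 0 ≤ κ x) ∧ ∫ x, κ x = 1 := by
  let b : ContDiffBump (0 : ℝ) := default
  exact ⟨b.normed volume, b.contDiff_normed, b.hasCompactSupport_normed, b.nonneg_normed,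
    b.integral_normed⟩

/-- A measure finite on compacts is determined by its integrals of compactly supported continuous
functions. The existence of one mollifier is essential: without it the convergence condition would
be vacuous. -/
theorem IsDiracComp.unique {f : ℝ → ℝ} {t : ℝ} {μ μ' : Measure ℝ} (h : IsDiracComp f t μ)
    (h' : IsDiracComp f t μ') : μ = μ' := by
  obtain ⟨κ, h1, h2, h3, h4⟩ := exists_mollifier
  have := h.1
  have := h'.1
  refine Measure.ext_of_integral_eq_on_compactlySupported fun v => ?_
  exact tendsto_nhds_unique (h.2 κ h1 h2 h3 h4 v v.continuous v.hasCompactSupport)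
    (h'.2 κ h1 h2 h3 h4 v v.continuous v.hasCompactSupport)

theorem IsDiracComp.isDiracComp_diracComp {f : ℝ → ℝ} {t : ℝ} {μ : Measure ℝ}
    (h : IsDiracComp f t μ) : IsDiracComp f t (diracComp f t) := by
  have hex : ∃ μ : Measure ℝ, IsDiracComp f t μ := ⟨μ, h⟩
  rw [diracComp, dif_pos hex]
  exact hex.choose_spec

theorem IsDiracComp.diracComp_eq {f : ℝ → ℝ} {t : ℝ} {μ : Measure ℝ} (h : IsDiracComp f t μ) :
    diracComp f t = μ :=
  h.isDiracComp_diracComp.unique h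

theorem integral_rescaled_mollifier {κ : ℝ → ℝ} (h1 : ∫ x, κ x = 1) {ε : ℝ} (hε : 0 < ε) (t : ℝ) :
    ∫ u, ε⁻¹ * κ ((t - u) / ε) = 1 := by
  rw [integral_const_mul, integral_sub_left_eq_self (fun u => κ (u / ε)) volume t,
    Measure.integral_comp_div, h1, abs_of_pos hε, smul_eq_mul, mul_one, inv_mul_cancel₀ hε.ne']

/-- Writing `v = f' * w`, the kernel `g (f s) * f' s` has mass 1 after the substitution `u = f s`
and concentrates at `ξ`. The integral thus converges to `w ξ = v ξ / f' ξ`. -/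
theorem isDiracComp_smul_dirac {f f' : ℝ → ℝ} {t ξ : ℝ} (hf : ∀ x, HasDerivAt f (f' x) x)
    (hc : Continuous f') (hpos : ∀ x, 0 < f' x) (hξ : f ξ = t) :
    IsDiracComp f t (ENNReal.ofReal (1 / f' ξ) • Measure.dirac ξ) := by
  have hmono : StrictMono f := strictMono_of_hasDerivAt_pos hf hpos
  have hfc : Continuous f := continuous_iff_continuousAt.2 fun x => (hf x).continuousAt
  refine ⟨?_, fun κ κs κc κ0 κ1 v hv hvc => ?_⟩
  · have : IsFiniteMeasure (ENNReal.ofReal (1 / f' ξ) • Measure.dirac ξ) :=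
      Measure.smul_finite _ ENNReal.ofReal_ne_top
    infer_instance
  set w : ℝ → ℝ := fun s => v s / f' s with hw
  have hwc : Continuous w := hv.div hc fun x => (hpos x).ne'
  have hlim : ∫ s, v s ∂(ENNReal.ofReal (1 / f' ξ) • Measure.dirac ξ) = w ξ := by
    rw [integral_smul_measure, integral_dirac, ENNReal.toReal_ofReal (by have := hpos ξ; positivity),
      smul_eq_mul, hw]
    ring
  rw [hlim, Metric.tendsto_nhds]
  intro δ hδ
  obtain ⟨R, hR, hκ⟩ := κc.exists_pos_le_norm
  obtain ⟨r, hr, hwr⟩ := Metric.continuousAt_iff.1 (hwc.continuousAt (x := ξ)) (δ / 2) (half_pos hδ)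
  -- The radius is halved so that the closed interval from `p` to `q` lies in the open ball where
  -- `w` is within `δ / 2` of `w ξ`.
  set p := ξ - r / 2 with hp
  set q := ξ + r / 2 with hq
  have hpt : f p < t := hξ ▸ hmono (by linarith)
  have hqt : t < f q := hξ ▸ hmono (by linarith)
  have hpq : p ≤ q := by linarith
  -- With `κ` vanishing where `|x| ≥ R`, the two bounds on `ε` confine the rescaled mollifier to
  -- values between `f p` and `f q`.
  filter_upwards [self_mem_nhdsWithin, mem_nhdsWithin_of_mem_nhds
    (Iio_mem_nhds (show 0 < (t - f p) / R from div_pos (by linarith) hR)),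
    mem_nhdsWithin_of_mem_nhds
    (Iio_mem_nhds (show 0 < (f q - t) / R from div_pos (by linarith) hR))] with ε hε h1 h2
  have hε : 0 < ε := hε
  have h1 : ε * R < t - f p := (lt_div_iff₀ hR).1 h1
  have h2 : ε * R < f q - t := (lt_div_iff₀ hR).1 h2
  set g : ℝ → ℝ := fun u => ε⁻¹ * κ ((t - u) / ε) with hg
  have hgc : Continuous g := by
    have := κs.continuous
    fun_prop
  have hg0 : ∀ u, 0 ≤ g u := fun u => mul_nonneg (inv_nonneg.2 hε.le) (κ0 _)
  have hgl : ∀ u, u ≤ f p → g u = 0 := by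
    intro u hu
    rw [hg]
    simp only
    rw [hκ, mul_zero]
    rw [Real.norm_eq_abs]
    refine le_trans ?_ (le_abs_self _)
    rw [le_div_iff₀ hε]
    linarith
  have hgr : ∀ u, f q ≤ u → g u = 0 := by
    intro u hu
    rw [hg]
    simp only
    rw [hκ, mul_zero]
    rw [Real.norm_eq_abs]
    refine le_trans ?_ (neg_le_abs _)
    rw [← neg_div, le_div_iff₀ hε]
    linarith
  have hK : ∫ s in p..q, g (f s) * f' s = 1 := by
    have := intervalIntegral.integral_comp_mul_deriv (a := p) (b := q) (fun x _ => hf x)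
      hc.continuousOn hgc
    simp only [Function.comp] at this
    rw [this, intervalIntegral.integral_eq_integral_of_support_subset,
      integral_rescaled_mollifier κ1 hε]
    intro u hu
    refine ⟨lt_of_not_ge fun h => hu (hgl u h), le_of_not_gt fun h => hu (hgr u h.le)⟩
  have hI : ∫ s, ε⁻¹ * κ ((t - f s) / ε) * v s = ∫ s in p..q, (g (f s) * f' s) * w s := by
    rw [intervalIntegral.integral_eq_integral_of_support_subset]
    · refine integral_congr_ae (Eventually.of_forall fun s => ?_)
      have := (hpos s).ne'
      simp only [hg, hw]
      field_simp
    · intro s hs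
      refine ⟨lt_of_not_ge fun h => hs ?_, le_of_not_gt fun h => hs ?_⟩
      · simp [hgl _ (hmono.monotone h)]
      · simp [hgr _ (hmono.monotone h.le)]
  have hKc : Continuous fun s => g (f s) * f' s := (hgc.comp hfc).mul hc
  have hdiff : (∫ s in p..q, (g (f s) * f' s) * w s) - w ξ =
      ∫ s in p..q, (g (f s) * f' s) * (w s - w ξ) := by
    have i1 : IntervalIntegrable (fun s => g (f s) * f' s * w s) volume p q :=
      (hKc.mul hwc).intervalIntegrable _ _
    have i2 : IntervalIntegrable (fun s => g (f s) * f' s * w ξ) volume p q :=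
      (hKc.mul continuous_const).intervalIntegrable _ _
    simp only [mul_sub]
    rw [intervalIntegral.integral_sub i1 i2, intervalIntegral.integral_mul_const, hK, one_mul]
  rw [hI, Real.dist_eq, hdiff, ← Real.norm_eq_abs]
  refine lt_of_le_of_lt (intervalIntegral.norm_integral_le_of_norm_le hpq
    (g := fun s => (g (f s) * f' s) * (δ / 2)) (Eventually.of_forall fun s hs => ?_)
    ((hKc.mul continuous_const).intervalIntegrable _ _)) ?_
  · have hk : 0 ≤ g (f s) * f' s := mul_nonneg (hg0 _) (hpos s).le
    rw [norm_mul, Real.norm_of_nonneg hk]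
    refine mul_le_mul_of_nonneg_left ?_ hk
    have : dist s ξ < r := by
      rw [Real.dist_eq, abs_lt]
      constructor <;> linarith [hs.1, hs.2]
    exact (hwr this).le
  · rw [intervalIntegral.integral_mul_const, hK]
    linarith

theorem isDiracComp_zero {f : ℝ → ℝ} {t : ℝ} (hf : Continuous f) (hlim : Tendsto f atTop atTop)
    (ht : ∀ s, f s ≠ t) : IsDiracComp f t 0 := by
  -- A value at most `t` together with growth at infinity would make `f` attain `t`, by the
  -- intermediate value theorem.
  have hgt : ∀ s, t < f s := by
    intro s
    by_contra! h
    obtain ⟨s', hs'⟩ := ((hlim.eventually_ge_atTop t).and (eventually_ge_atTop s)).exists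
    obtain ⟨x, -, hx⟩ := intermediate_value_Icc hs'.2 hf.continuousOn ⟨h, hs'.1⟩
    exact ht x hx
  refine ⟨inferInstance, fun κ κs κc κ0 κ1 v hv hvc => ?_⟩
  obtain ⟨R, hR, hκ⟩ := κc.exists_pos_le_norm
  -- Compactness leaves a gap `a - t > 0` below `f` on the support of `v`; once `ε * R` is smaller
  -- than the gap, the integrand is zero.
  obtain ⟨a, hta, ha⟩ := IsCompact.exists_forall_le' hvc hf.continuousOn fun s _ => hgt s
  rw [integral_zero_measure]
  refine tendsto_const_nhds.congr' ?_
  filter_upwards [self_mem_nhdsWithin, mem_nhdsWithin_of_mem_nhds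
    (Iio_mem_nhds (show 0 < (a - t) / R from div_pos (by linarith) hR))] with ε hε h1
  have hε : 0 < ε := hε
  have h1 : ε * R < a - t := (lt_div_iff₀ hR).1 h1
  rw [eq_comm]
  refine integral_eq_zero_of_ae (Eventually.of_forall fun s => ?_)
  by_cases hs : s ∈ tsupport v
  · have hz : κ ((t - f s) / ε) = 0 := by
      refine hκ _ ?_
      rw [Real.norm_eq_abs]
      refine le_trans ?_ (neg_le_abs _)
      rw [← neg_div, le_div_iff₀ hε]
      linarith [ha s hs]
    simp [hz]
  · simp [image_eq_zero_of_notMem_tsupport hs]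


/-! ### Extension by zero -/

/-- `G` is not known to be differentiable off `V`, so the mean value theorem is applied only from
the last point `s₁ ∉ V` before `s`: there `G` vanishes, and between `s₁` and `s` one stays inside
`V`. -/
theorem abs_le_mul_sub_of_zero_off {G G' : ℝ → ℝ} {V : Set ℝ} (hV : IsOpen V)
    (h0 : ∀ x ∉ V, G x = 0) (hd : ∀ x ∈ V, HasDerivAt G (G' x) x) (hG : Continuous G)
    {s₀ s ε : ℝ} (hs : s₀ ≤ s) (hs₀ : s₀ ∉ V) (hε : ∀ x ∈ Set.Icc s₀ s, |G' x| ≤ ε) :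
    |G s| ≤ ε * (s - s₀) := by
  have hε0 : 0 ≤ ε := (abs_nonneg _).trans (hε s₀ ⟨le_rfl, hs⟩)
  by_cases hsV : s ∉ V
  · rw [h0 s hsV, abs_zero]
    exact mul_nonneg hε0 (by linarith)
  rw [not_not] at hsV
  have hAc : IsCompact (Set.Icc s₀ s ∩ Vᶜ) := isCompact_Icc.inter_right hV.isClosed_compl
  have hAn : (Set.Icc s₀ s ∩ Vᶜ).Nonempty := ⟨s₀, ⟨le_rfl, hs⟩, hs₀⟩
  obtain ⟨s₁, ⟨⟨h01, h1s⟩, h1V⟩, hub⟩ := hAc.exists_isGreatest hAn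
  have hlt : s₁ < s := lt_of_le_of_ne h1s fun h => h1V (h ▸ hsV)
  obtain ⟨c, hc, e⟩ := exists_hasDerivAt_eq_slope G G' hlt hG.continuousOn fun x hx => hd x <| by
    by_contra hxV
    exact absurd (hub ⟨⟨h01.trans hx.1.le, hx.2.le⟩, hxV⟩) (not_le.2 hx.1)
  rw [h0 s₁ h1V, sub_zero, eq_div_iff (sub_pos.2 hlt).ne'] at e
  rw [← e, abs_mul, abs_of_pos (sub_pos.2 hlt)]
  exact mul_le_mul (hε c ⟨h01.trans hc.1.le, hc.2.le⟩) (by linarith) (sub_pos.2 hlt).le hε0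

theorem hasDerivAt_zero_of_zero_off {G G' : ℝ → ℝ} {V : Set ℝ} (hV : IsOpen V)
    (h0 : ∀ x ∉ V, G x = 0) (hd : ∀ x ∈ V, HasDerivAt G (G' x) x) (hG : Continuous G)
    (hG' : Continuous G') {s₀ : ℝ} (hs₀ : s₀ ∉ V) (hz : G' s₀ = 0) : HasDerivAt G 0 s₀ := by
  rw [hasDerivAt_iff_isLittleO, Asymptotics.isLittleO_iff]
  intro ε hε
  obtain ⟨δ, hδ, hb⟩ := Metric.continuousAt_iff.1 (hG'.continuousAt (x := s₀)) ε hε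
  filter_upwards [Metric.ball_mem_nhds s₀ hδ] with s hs
  rw [Metric.mem_ball, Real.dist_eq, abs_lt] at hs
  rw [h0 s₀ hs₀, smul_zero, sub_zero, sub_zero, Real.norm_eq_abs, Real.norm_eq_abs]
  have hbd : ∀ x, |x - s₀| < δ → |G' x| ≤ ε := fun x hx => by
    have := hb (x := x) (by rwa [Real.dist_eq])
    rw [hz, Real.dist_eq, sub_zero] at this
    exact this.le
  rcases le_total s₀ s with h | h
  · rw [abs_of_nonneg (sub_nonneg.2 h)]
    refine abs_le_mul_sub_of_zero_off hV h0 hd hG h hs₀ fun x hx => hbd x ?_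
    rw [abs_lt]
    constructor <;> linarith [hx.1, hx.2]
  · rw [abs_of_nonpos (sub_nonpos.2 h)]
    -- The left side of `s₀` reduces to the right side by reflection.
    have := abs_le_mul_sub_of_zero_off (G := fun x => G (-x)) (G' := fun x => -G' (-x))
      (V := Neg.neg ⁻¹' V) (hV.preimage continuous_neg) (fun x hx => h0 _ hx)
      (fun x hx => by
        have := (hd (-x) hx).comp x (hasDerivAt_neg x)
        rwa [mul_neg_one] at this)
      (hG.comp continuous_neg) (neg_le_neg h) (by simpa using hs₀) (ε := ε) (fun x hx => by
        rw [abs_neg]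
        refine hbd _ ?_
        rw [abs_lt]
        constructor <;> linarith [hx.1, hx.2])
    rw [neg_neg] at this
    linarith

theorem hasPartial_of_zero_off {n : ℕ} {i : Fin n} {g g' : (Fin n → ℝ) → ℝ} {V : Set (Fin n → ℝ)}
    (hV : IsOpen V) (hg : Continuous g) (hg' : Continuous g') (h0 : ∀ y ∉ V, g y = 0)
    (h0' : ∀ y ∉ V, g' y = 0)
    (hd : ∀ y ∈ V, HasDerivAt (fun s : ℝ => g (Function.update y i s)) (g' y) (y i)) :
    HasPartial i g g' := by
  intro y
  by_cases hy : y ∈ V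
  · exact hd y hy
  rw [h0' y hy]
  have hu : Continuous fun s : ℝ => Function.update y i s := continuous_const.update i continuous_id
  refine hasDerivAt_zero_of_zero_off (G' := fun s => g' (Function.update y i s))
    (V := (fun s : ℝ => Function.update y i s) ⁻¹' V) (hV.preimage hu) (fun s hs => h0 _ hs)
    (fun s hs => ?_) (hg.comp hu) (hg'.comp hu) (by simpa using hy) (by simpa using h0' y hy)
  simpa using hd _ hs

/-! ### The implicit function `ξ` -/

section Implicit

variable {d : ℕ}

theorem update_pt_zero (s u : ℝ) (y : Fin d → ℝ) : Function.update (pt s y) 0 u = pt u y :=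
  Fin.update_cons_zero _ _ _

theorem update_pt_succ (s u : ℝ) (y : Fin d → ℝ) (i : Fin d) :
    Function.update (pt s y) i.succ u = pt s (Function.update y i u) :=
  (Fin.cons_update _ _ _ _).symm

theorem continuous_pt : Continuous fun p : ℝ × (Fin d → ℝ) => pt p.1 p.2 := by
  refine continuous_pi fun j => ?_
  refine Fin.cases ?_ (fun i => ?_) j
  · exact continuous_fst
  · exact (continuous_apply i).comp continuous_snd

theorem HasPartial.hasDerivAt_pt {g g' : (Fin (d + 1) → ℝ) → ℝ} (h : HasPartial 0 g g')
    (y : Fin d → ℝ) (s : ℝ) : HasDerivAt (fun s => g (pt s y)) (g' (pt s y)) s := by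
  have := h (pt s y)
  simp only [update_pt_zero] at this
  exact this

theorem HasPartial.hasDerivAt_pt_update {g g' : (Fin (d + 1) → ℝ) → ℝ} {i : Fin d}
    (h : HasPartial i.succ g g') (y : Fin d → ℝ) (s : ℝ) :
    HasDerivAt (fun u => g (pt s (Function.update y i u))) (g' (pt s y)) (y i) := by
  have := h (pt s y)
  simp only [update_pt_succ] at this
  exact this

/-- Carathéodory's form of differentiability: increments are factored as a convergent quotient times
a difference, which composes without division by zero. -/
theorem hasDerivAt_of_eventually_eq_mul {f q : ℝ → ℝ} {s₀ q₀ : ℝ}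
    (h : ∀ᶠ s in 𝓝 s₀, f s - f s₀ = q s * (s - s₀)) (hq : Tendsto q (𝓝 s₀) (𝓝 q₀)) :
    HasDerivAt f q₀ s₀ := by
  rw [hasDerivAt_iff_tendsto_slope]
  refine (hq.mono_left nhdsWithin_le_nhds).congr' ?_
  filter_upwards [nhdsWithin_le_nhds h, self_mem_nhdsWithin] with s hs hne
  rw [slope_def_field, hs, mul_div_cancel_right₀ _ (sub_ne_zero.2 hne)]

theorem exists_tendsto_of_hasDerivAt {f : ℝ → ℝ} {s₀ f' : ℝ} (h : HasDerivAt f f' s₀) :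
    ∃ q : ℝ → ℝ, Tendsto q (𝓝 s₀) (𝓝 f') ∧ ∀ s, f s - f s₀ = q s * (s - s₀) := by
  refine ⟨dslope f s₀, ?_, fun s => ?_⟩
  · have := (continuousAt_dslope_same.2 h.differentiableAt).tendsto
    rwa [dslope_same, h.deriv] at this
  · rw [← sub_smul_dslope f s₀ s, smul_eq_mul, mul_comm]

theorem exists_tendsto_quotient {g g' : (Fin (d + 1) → ℝ) → ℝ} (h : HasPartial 0 g g')
    (hg' : Continuous g') {x : ℝ → ℝ} {i : Fin d} {y : Fin d → ℝ} (hx : ContinuousAt x (y i)) :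
    ∃ Q : ℝ → ℝ, Tendsto Q (𝓝 (y i)) (𝓝 (g' (pt (x (y i)) y))) ∧
      ∀ s, g (pt (x s) (Function.update y i s)) - g (pt (x (y i)) (Function.update y i s)) =
        Q s * (x s - x (y i)) := by
  choose θ hθ e using fun s => exists_eq_deriv_mul_sub
    (fun u => h.hasDerivAt_pt (Function.update y i s) u) (x (y i)) (x s)
  refine ⟨_, ?_, e⟩
  have h1 : Tendsto θ (𝓝 (y i)) (𝓝 (x (y i))) := tendsto_of_mem_uIcc hθ hx
  have h2 : Tendsto (fun s => Function.update y i s) (𝓝 (y i)) (𝓝 y) := by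
    have : Continuous fun s : ℝ => Function.update y i s := continuous_const.update i continuous_id
    simpa using this.tendsto (y i)
  exact (hg'.comp continuous_pt).continuousAt.tendsto.comp (h1.prodMk_nhds h2)

/-- The chain rule along a curve `(x(s), y + (s - y_i) e_i)`. -/
theorem HasPartial.hasDerivAt_comp {g g₀ g₁ : (Fin (d + 1) → ℝ) → ℝ} {i : Fin d}
    (h₀ : HasPartial 0 g g₀) (h₁ : HasPartial i.succ g g₁) (hg₀ : Continuous g₀) {x : ℝ → ℝ}
    {x' : ℝ} {y : Fin d → ℝ} (hx : HasDerivAt x x' (y i)) :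
    HasDerivAt (fun s => g (pt (x s) (Function.update y i s)))
      (g₁ (pt (x (y i)) y) + g₀ (pt (x (y i)) y) * x') (y i) := by
  obtain ⟨Q, hQ, eQ⟩ := exists_tendsto_quotient h₀ hg₀ hx.continuousAt
  obtain ⟨q, hq, eq⟩ := exists_tendsto_of_hasDerivAt (h₁.hasDerivAt_pt_update y (x (y i)))
  obtain ⟨p, hp, ep⟩ := exists_tendsto_of_hasDerivAt hx
  -- The increment is split into a move in `y_0` at the new `y`, which needs `g₀` continuous, and a
  -- move in `y_i` at fixed `y_0`, which needs only the derivative at the base point.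
  refine hasDerivAt_of_eventually_eq_mul (q := fun s => q s + Q s * p s)
    (Eventually.of_forall fun s => ?_) (hq.add (hQ.mul hp))
  have h1 := eQ s
  have h2 := eq s
  rw [ep s] at h1
  simp only [Function.update_eq_self] at h2 ⊢
  linear_combination h1 + h2

variable {φ φ₀ : (Fin (d + 1) → ℝ) → ℝ} {t : ℝ}

theorem strictMono_pt (h : HasPartial 0 φ φ₀) (hpos : ∀ x, 0 < φ₀ x) (y : Fin d → ℝ) :
    StrictMono fun s => φ (pt s y) :=
  strictMono_of_hasDerivAt_pos (h.hasDerivAt_pt y) fun _ => hpos _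

theorem apply_xi {y : Fin d → ℝ} (hy : y ∈ U φ t) : φ (pt (xi φ t y) y) = t := by
  have hy' : ∃ s : ℝ, φ (pt s y) = t := hy
  rw [xi, dif_pos hy']
  exact hy'.choose_spec

theorem xi_eq (h : HasPartial 0 φ φ₀) (hpos : ∀ x, 0 < φ₀ x) {y : Fin d → ℝ} {s : ℝ}
    (hs : φ (pt s y) = t) : xi φ t y = s :=
  (strictMono_pt h hpos y).injective ((apply_xi ⟨s, hs⟩).trans hs.symm)

/-- The values of `φ` at `ξ ± ε` lie strictly on either side of `t`, and they still do so for nearby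
`z`; the intermediate value theorem puts the new solution between `ξ - ε` and `ξ + ε`. -/
theorem eventually_mem_U (hφ : Continuous φ) (h : HasPartial 0 φ φ₀) (hpos : ∀ x, 0 < φ₀ x)
    {y : Fin d → ℝ} (hy : y ∈ U φ t) {ε : ℝ} (hε : 0 < ε) :
    ∀ᶠ z in 𝓝 y, z ∈ U φ t ∧ dist (xi φ t z) (xi φ t y) < ε := by
  have hc : ∀ s, Continuous fun z : Fin d → ℝ => φ (pt s z) := fun s =>
    hφ.comp (continuous_pt.comp (continuous_const.prodMk continuous_id))
  have hc' : ∀ z : Fin d → ℝ, Continuous fun s => φ (pt s z) := fun z =>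
    hφ.comp (continuous_pt.comp (continuous_id.prodMk continuous_const))
  have hm := strictMono_pt h hpos
  have h1 : φ (pt (xi φ t y - ε) y) < t := by
    conv_rhs => rw [← apply_xi hy]
    exact hm y (by linarith)
  have h2 : t < φ (pt (xi φ t y + ε) y) := by
    conv_lhs => rw [← apply_xi hy]
    exact hm y (by linarith)
  filter_upwards [(hc _).continuousAt.eventually_lt_const h1,
    (hc _).continuousAt.eventually_const_lt h2] with z hz1 hz2
  obtain ⟨s, hs, e⟩ := intermediate_value_Ioo (by linarith : xi φ t y - ε ≤ xi φ t y + ε)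
    (hc' z).continuousOn ⟨hz1, hz2⟩
  refine ⟨⟨s, e⟩, ?_⟩
  rw [xi_eq h hpos e, Real.dist_eq, abs_lt]
  constructor <;> linarith [hs.1, hs.2]

theorem isOpen_U (hφ : Continuous φ) (h : HasPartial 0 φ φ₀) (hpos : ∀ x, 0 < φ₀ x) :
    IsOpen (U φ t) :=
  isOpen_iff_mem_nhds.2 fun _ hy =>
    (eventually_mem_U hφ h hpos hy one_pos).mono fun _ hz => hz.1

theorem continuousAt_xi (hφ : Continuous φ) (h : HasPartial 0 φ φ₀) (hpos : ∀ x, 0 < φ₀ x)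
    {y : Fin d → ℝ} (hy : y ∈ U φ t) : ContinuousAt (xi φ t) y :=
  Metric.tendsto_nhds.2 fun _ hε =>
    (eventually_mem_U hφ h hpos hy hε).mono fun _ hz => hz.2

theorem hasDerivAt_xi (hφ : Continuous φ) (h : HasPartial 0 φ φ₀) (hpos : ∀ x, 0 < φ₀ x)
    (hφ₀ : Continuous φ₀) {i : Fin d} {φ₁ : (Fin (d + 1) → ℝ) → ℝ} (h₁ : HasPartial i.succ φ φ₁)
    {y : Fin d → ℝ} (hy : y ∈ U φ t) :
    HasDerivAt (fun s => xi φ t (Function.update y i s))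
      (-(φ₁ (pt (xi φ t y) y) / φ₀ (pt (xi φ t y) y))) (y i) := by
  have hu : Continuous fun s : ℝ => Function.update y i s := continuous_const.update i continuous_id
  have hx : ContinuousAt (fun s => xi φ t (Function.update y i s)) (y i) :=
    ContinuousAt.comp (g := xi φ t) (by simpa using continuousAt_xi hφ h hpos hy) hu.continuousAt
  obtain ⟨Q, hQ, eQ⟩ := exists_tendsto_quotient h hφ₀ hx
  simp only [Function.update_eq_self] at hQ eQ
  obtain ⟨q, hq, eq⟩ := exists_tendsto_of_hasDerivAt (h₁.hasDerivAt_pt_update y (xi φ t y))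
  have hUe : ∀ᶠ s in 𝓝 (y i), Function.update y i s ∈ U φ t :=
    hu.continuousAt.eventually_mem (by simpa using (isOpen_U hφ h hpos).mem_nhds hy)
  -- `φ` equals `t` at both solutions, so the two partial increments cancel; this is solved for the
  -- increment of `ξ`, as `Q` has a nonzero limit.
  refine hasDerivAt_of_eventually_eq_mul (q := fun s => -(q s / Q s)) ?_ (hq.div hQ (hpos _).ne').neg
  filter_upwards [hUe, hQ.eventually_ne (hpos _).ne'] with s hs hne
  have h1 := eQ s
  have h2 := eq s
  simp only [Function.update_eq_self] at h2 ⊢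
  rw [apply_xi hs] at h1
  rw [apply_xi hy] at h2
  field_simp
  linear_combination -h1 - h2

end Implicit


/-- At a point outside `V`, the approach from within `V` is controlled by the boundary condition, or
is empty away from the closure; from the complement the function is constantly zero. -/
theorem continuous_indicator_of_tendsto_zero {X : Type*} [TopologicalSpace X] {V : Set X}
    {f : X → ℝ} (hV : IsOpen V) (hf : ∀ x ∈ V, ContinuousAt f x)
    (h0 : ∀ z ∈ frontier V, Tendsto f (𝓝[V] z) (𝓝 0)) : Continuous (V.indicator f) := by
  refine continuous_iff_continuousAt.2 fun z => ?_
  by_cases hz : z ∈ V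
  · refine (hf z hz).congr ?_
    filter_upwards [hV.mem_nhds hz] with x hx
    rw [Set.indicator_of_mem hx]
  · have h1 : Tendsto f (𝓝[V] z) (𝓝 0) := by
      by_cases hc : z ∈ closure V
      · exact h0 z ⟨hc, by rwa [hV.interior_eq]⟩
      · rw [notMem_closure_iff_nhdsWithin_eq_bot.1 hc]
        exact tendsto_bot
    rw [ContinuousAt, Set.indicator_of_notMem hz, ← nhdsWithin_univ, ← Set.union_compl_self V,
      nhdsWithin_union]
    refine Tendsto.sup (h1.congr' ?_) (tendsto_const_nhds.congr' ?_)
    · filter_upwards [self_mem_nhdsWithin] with x hx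
      rw [Set.indicator_of_mem hx]
    · filter_upwards [self_mem_nhdsWithin] with x hx
      rw [Set.indicator_of_notMem hx]

/-! ### Symbolic differentiation of the functions `h` -/

/-- All lists obtained from a list by adding `e` to one of its members. -/
def addEach {M : Type*} [Add M] (e : M) : List M → List (List M)
  | [] => []
  | a :: l => ((a + e) :: l) :: (addEach e l).map (List.cons a)

theorem length_addEach {M : Type*} [Add M] (e : M) (l : List M) :
    (addEach e l).length = l.length := by
  induction l with
  | nil => rfl
  | cons a l ih => simp [addEach, ih]

theorem length_of_mem_addEach {M : Type*} [Add M] {e : M} {l l' : List M} (h : l' ∈ addEach e l) :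
    l'.length = l.length := by
  induction l generalizing l' with
  | nil => simp [addEach] at h
  | cons a l ih =>
    simp only [addEach, List.mem_cons, List.mem_map] at h
    rcases h with rfl | ⟨k, hk, rfl⟩
    · rfl
    · simp [ih hk]

theorem mem_of_mem_addEach {M : Type*} [Add M] {e : M} {l l' : List M} (h : l' ∈ addEach e l)
    {b : M} (hb : b ∈ l') : b ∈ l ∨ ∃ a ∈ l, b = a + e := by
  induction l generalizing l' with
  | nil => simp [addEach] at h
  | cons a l ih =>
    simp only [addEach, List.mem_cons, List.mem_map] at h
    rcases h with rfl | ⟨k, hk, rfl⟩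
    · rcases List.mem_cons.1 hb with rfl | hb
      · exact Or.inr ⟨a, List.mem_cons_self, rfl⟩
      · exact Or.inl (List.mem_cons_of_mem _ hb)
    · rcases List.mem_cons.1 hb with rfl | hb
      · exact Or.inl List.mem_cons_self
      · rcases ih hk hb with h | ⟨c, hc, h⟩
        · exact Or.inl (List.mem_cons_of_mem _ h)
        · exact Or.inr ⟨c, List.mem_cons_of_mem _ hc, h⟩

theorem sum_of_mem_addEach {ι : Type*} {e : ι → ℕ} {l l' : List (ι → ℕ)} (h : l' ∈ addEach e l)
    (j : ι) : (l'.map (· j)).sum = (l.map (· j)).sum + e j := by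
  induction l generalizing l' with
  | nil => simp [addEach] at h
  | cons a l ih =>
    simp only [addEach, List.mem_cons, List.mem_map] at h
    rcases h with rfl | ⟨k, hk, rfl⟩
    · simp only [List.map_cons, List.sum_cons, Pi.add_apply]; omega
    · simp only [List.map_cons, List.sum_cons, ih hk]; omega

/-- The Leibniz rule along a curve. In the application `e = e_i`, `e' = e_0` and `-k` is the slope
of `ξ`, so each factor contributes a direct derivative and one through `ξ`. -/
theorem hasDerivAt_list_prod {M : Type*} [Add M] {A : ℝ → M → ℝ} {s₀ k : ℝ} {e e' : M}
    {l : List M}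
    (h : ∀ a ∈ l, HasDerivAt (fun s => A s a) (A s₀ (a + e) - A s₀ (a + e') * k) s₀) :
    HasDerivAt (fun s => (l.map (A s)).prod)
      (((addEach e l).map fun l' => (l'.map (A s₀)).prod).sum -
        ((addEach e' l).map fun l' => (l'.map (A s₀)).prod).sum * k) s₀ := by
  induction l with
  | nil => simpa [addEach] using hasDerivAt_const s₀ (1 : ℝ)
  | cons a l ih =>
    have h1 := (h a List.mem_cons_self).mul (ih fun b hb => h b (List.mem_cons_of_mem _ hb))
    have e2 : ∀ L : List (List M), ((L.map (List.cons a)).map fun l' => (l'.map (A s₀)).prod).sum =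
        A s₀ a * (L.map fun l' => (l'.map (A s₀)).prod).sum := by
      intro L
      rw [List.map_map, ← List.sum_map_mul_left]
      congr 1
    simp only [addEach, List.map_cons, List.sum_cons, List.prod_cons, e2]
    refine h1.congr_deriv ?_
    ring

/-- The parameters `(α, β)` of a function `h`; the parameter `r` is the length of `α`. -/
abbrev Term (d : ℕ) : Type := List (Fin (d + 1) → ℕ) × ℕ

namespace Term

variable {d : ℕ}

/-- The value of `h`, given the values `A α` of the derivatives of `φ` and `R β` of those of `ρ₀`. -/
def eval (A : (Fin (d + 1) → ℕ) → ℝ) (R : ℕ → ℝ) (T : Term d) : ℝ :=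
  ((-1) ^ T.1.length * R T.2 * (T.1.map A).prod) / A (Pi.single 0 1) ^ (T.1.length + 1)

/-- The terms of the partial derivative of `h` in the variable `y_i`. -/
def diff (i : Fin d) (T : Term d) : List (Term d) :=
  (Pi.single i.succ 1 :: T.1, T.2 + 1) ::
    ((addEach (Pi.single i.succ 1) T.1).map (fun l => (l, T.2)) ++
      ((addEach (Pi.single 0 1) T.1).map (fun l => (Pi.single i.succ 1 :: l, T.2)) ++
        (List.replicate (T.1.length + 1)
            ((Pi.single 0 1 + Pi.single i.succ 1) :: T.1, T.2) ++
          List.replicate (T.1.length + 1)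
            ((Pi.single 0 1 + Pi.single 0 1) :: Pi.single i.succ 1 :: T.1, T.2))))

/-- One term comes from `ρ₀`, `r` each from the product directly and through `ξ`, and `r + 1` each
from the denominator directly and through `ξ`. -/
theorem length_diff (i : Fin d) (T : Term d) : (diff i T).length = 4 * T.1.length + 3 := by
  simp only [diff, List.length_cons, List.length_append, List.length_map, length_addEach,
    List.length_replicate]
  omega

theorem sum_map_eval {A : (Fin (d + 1) → ℕ) → ℝ} {R : ℕ → ℝ} {r β : ℕ}
    {L : List (List (Fin (d + 1) → ℕ))} (hL : ∀ l ∈ L, l.length = r) :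
    (L.map fun l => eval A R (l, β)).sum =
      (-1) ^ r * R β / A (Pi.single 0 1) ^ (r + 1) * (L.map fun l => (l.map A).prod).sum := by
  rw [← List.sum_map_mul_left]
  congr 1
  refine List.map_congr_left fun l hl => ?_
  simp only [eval, hL l hl]
  ring

theorem sum_map_eval_cons {A : (Fin (d + 1) → ℕ) → ℝ} {R : ℕ → ℝ} {r β : ℕ}
    {L : List (List (Fin (d + 1) → ℕ))} (hL : ∀ l ∈ L, l.length = r) (e : Fin (d + 1) → ℕ) :
    (L.map fun l => eval A R (e :: l, β)).sum =
      (-1) ^ (r + 1) * R β / A (Pi.single 0 1) ^ (r + 1 + 1) * A e *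
        (L.map fun l => (l.map A).prod).sum := by
  rw [← List.sum_map_mul_left]
  congr 1
  refine List.map_congr_left fun l hl => ?_
  simp only [eval, List.length_cons, hL l hl, List.map_cons, List.prod_cons]
  ring

/-- The quotient rule with the slope of `ξ` equal to `-D^i φ / D^0 φ`. Every new minus sign comes
with one new factor and one more power of `D^0 φ`, so the shape of `h` is preserved. -/
theorem hasDerivAt_eval {A : ℝ → (Fin (d + 1) → ℕ) → ℝ} {R : ℝ → ℕ → ℝ} {s₀ : ℝ} {i : Fin d}
    {T : Term d} (h0 : A s₀ (Pi.single 0 1) ≠ 0)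
    (hA : ∀ a ∈ Pi.single 0 1 :: T.1, HasDerivAt (fun s => A s a) (A s₀ (a + Pi.single i.succ 1) -
      A s₀ (a + Pi.single 0 1) * (A s₀ (Pi.single i.succ 1) / A s₀ (Pi.single 0 1))) s₀)
    (hR : HasDerivAt (fun s => R s T.2)
      (-(R s₀ (T.2 + 1) * (A s₀ (Pi.single i.succ 1) / A s₀ (Pi.single 0 1)))) s₀) :
    HasDerivAt (fun s => eval (A s) (R s) T) ((diff i T).map (eval (A s₀) (R s₀))).sum s₀ := by
  have hP := hasDerivAt_list_prod fun a ha => hA a (List.mem_cons_of_mem _ ha)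
  have hD := (hA _ List.mem_cons_self).fun_pow (T.1.length + 1)
  have hN := ((hR.const_mul ((-1 : ℝ) ^ T.1.length)).mul hP).div hD (pow_ne_zero _ h0)
  refine hN.congr_deriv ?_
  simp only [diff, List.map_cons, List.map_append, List.map_map, List.sum_cons, List.sum_append,
    List.map_replicate, List.sum_replicate, Function.comp_def]
  rw [sum_map_eval fun l hl => length_of_mem_addEach hl,
    sum_map_eval_cons fun l hl => length_of_mem_addEach hl]
  simp only [eval, List.length_cons, List.map_cons, List.prod_cons, nsmul_eq_mul,
    Nat.add_sub_cancel, Pi.mul_apply]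
  field_simp
  push_cast
  ring

/-- The constraints on the parameters of the terms in the derivative of `h` along a word. -/
structure IsGood (w : List (Fin d)) (T : Term d) : Prop where
  ne_zero : ∀ a ∈ T.1, a ≠ 0
  ne_single : ∀ a ∈ T.1, a ≠ Pi.single 0 1
  zero_le : ∀ a ∈ T.1, a 0 ≤ w.length + 1
  beta_le : T.2 ≤ w.length
  length_le : T.1.length ≤ 2 * w.length
  sum_zero : T.2 + (T.1.map (· 0)).sum = T.1.length
  sum_succ : ∀ i : Fin d, (T.1.map (· i.succ)).sum = wordIdx w i

theorem isGood_nil : IsGood [] (([], 0) : Term d) := by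
  constructor <;> simp [wordIdx]

theorem add_single_succ_ne (a : Fin (d + 1) → ℕ) (i : Fin d) :
    a + Pi.single i.succ 1 ≠ 0 ∧ a + Pi.single i.succ 1 ≠ Pi.single 0 1 := by
  constructor <;> intro h <;> simpa using congrFun h i.succ

theorem single_add_single_ne :
    (Pi.single 0 1 + Pi.single 0 1 : Fin (d + 1) → ℕ) ≠ 0 ∧
      (Pi.single 0 1 + Pi.single 0 1 : Fin (d + 1) → ℕ) ≠ Pi.single 0 1 := by
  constructor <;> intro h <;> simpa using congrFun h 0

/-- Passing through `ξ` adds one derivative in `y_0` and one factor `D^i φ`; differentiating the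
denominator adds a factor whose index contains an extra `e_0`. Hence `β + ∑ α_{l,0} = r` persists,
and `r` grows by at most 2, namely when the denominator is differentiated through `ξ`. -/
theorem IsGood.of_mem_diff {w : List (Fin d)} {T T' : Term d} (h : IsGood w T) {i : Fin d}
    (hT' : T' ∈ diff i T) : IsGood (i :: w) T' := by
  obtain ⟨α, β⟩ := T
  obtain ⟨h1, h2, h3, h4, h5, h6, h7⟩ := h
  simp only at h1 h2 h3 h4 h5 h6 h7
  have hs := add_single_succ_ne (0 : Fin (d + 1) → ℕ) i
  rw [zero_add] at hs
  have hs0 := add_single_succ_ne (Pi.single 0 1) i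
  have h00 := single_add_single_ne (d := d)
  have hw : ∀ j, wordIdx (i :: w) j = wordIdx w j + (Pi.single i.succ 1 : Fin (d + 1) → ℕ) j.succ := by
    intro j
    rw [wordIdx_cons, Pi.add_apply]
    rcases eq_or_ne j i with rfl | hj
    · simp
    · simp [hj]
  have hi0 : (Pi.single i.succ 1 : Fin (d + 1) → ℕ) 0 = 0 := by simp
  have h0s : ∀ j : Fin d, (Pi.single 0 1 : Fin (d + 1) → ℕ) j.succ = 0 := by simp
  have h0z : (Pi.single 0 1 : Fin (d + 1) → ℕ) 0 = 1 := by simp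
  simp only [diff, List.mem_cons, List.mem_append, List.mem_map, List.mem_replicate] at hT'
  rcases hT' with rfl | ⟨l, hl, rfl⟩ | ⟨l, hl, rfl⟩ | ⟨-, rfl⟩ | ⟨-, rfl⟩
  · constructor
    · simp only [List.forall_mem_cons]; exact ⟨hs.1, h1⟩
    · simp only [List.forall_mem_cons]; exact ⟨hs.2, h2⟩
    · simp only [List.forall_mem_cons, List.length_cons, hi0]
      exact ⟨by omega, fun a ha => (h3 a ha).trans (Nat.le_succ _)⟩
    · simp only [List.length_cons]; omega
    · simp only [List.length_cons]; omega
    · simp only [List.length_cons, List.map_cons, List.sum_cons, hi0]; omega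
    · intro j; simp only [List.map_cons, List.sum_cons, h7, hw]; omega
  · have hlen := length_of_mem_addEach hl
    constructor
    · intro b hb
      rcases mem_of_mem_addEach hl hb with hb | ⟨a, ha, rfl⟩
      · exact h1 b hb
      · exact (add_single_succ_ne a i).1
    · intro b hb
      rcases mem_of_mem_addEach hl hb with hb | ⟨a, ha, rfl⟩
      · exact h2 b hb
      · exact (add_single_succ_ne a i).2
    · intro b hb
      rw [List.length_cons]
      rcases mem_of_mem_addEach hl hb with hb | ⟨a, ha, rfl⟩
      · exact (h3 b hb).trans (Nat.le_succ _)
      · have := h3 a ha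
        rw [Pi.add_apply, hi0]; omega
    · simp only [List.length_cons]; omega
    · simp only [List.length_cons, hlen]; omega
    · simp only [sum_of_mem_addEach hl, hi0, hlen]; omega
    · intro j; simp only [sum_of_mem_addEach hl, h7, hw]
  · have hlen := length_of_mem_addEach hl
    constructor
    · intro b hb
      rcases List.mem_cons.1 hb with rfl | hb
      · exact hs.1
      rcases mem_of_mem_addEach hl hb with hb | ⟨a, ha, rfl⟩
      · exact h1 b hb
      · intro h; simpa using congrFun h 0
    · intro b hb
      rcases List.mem_cons.1 hb with rfl | hb
      · exact hs.2
      rcases mem_of_mem_addEach hl hb with hb | ⟨a, ha, rfl⟩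
      · exact h2 b hb
      -- Excluding the zero index from the factors is what prevents `a + e_0` from being `e_0`.
      · intro h; exact h1 a ha (by simpa using h)
    · intro b hb
      rw [List.length_cons]
      rcases List.mem_cons.1 hb with rfl | hb
      · rw [hi0]; omega
      rcases mem_of_mem_addEach hl hb with hb | ⟨a, ha, rfl⟩
      · exact (h3 b hb).trans (Nat.le_succ _)
      · have := h3 a ha
        rw [Pi.add_apply, h0z]; omega
    · simp only [List.length_cons]; omega
    · simp only [List.length_cons, hlen]; omega
    · simp only [List.length_cons, List.map_cons, List.sum_cons, sum_of_mem_addEach hl, hi0, h0z,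
        hlen]; omega
    · intro j
      simp only [List.map_cons, List.sum_cons, sum_of_mem_addEach hl, h7, hw, h0s]; omega
  · constructor
    · simp only [List.forall_mem_cons]; exact ⟨hs0.1, h1⟩
    · simp only [List.forall_mem_cons]; exact ⟨hs0.2, h2⟩
    · simp only [List.forall_mem_cons, List.length_cons, Pi.add_apply, hi0, h0z]
      exact ⟨by omega, fun a ha => (h3 a ha).trans (Nat.le_succ _)⟩
    · simp only [List.length_cons]; omega
    · simp only [List.length_cons]; omega
    · simp only [List.length_cons, List.map_cons, List.sum_cons, Pi.add_apply, hi0, h0z]; omega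
    · intro j; simp only [List.map_cons, List.sum_cons, Pi.add_apply, h7, hw, h0s]; omega
  · constructor
    · simp only [List.forall_mem_cons]; exact ⟨h00.1, hs.1, h1⟩
    · simp only [List.forall_mem_cons]; exact ⟨h00.2, hs.2, h2⟩
    · simp only [List.forall_mem_cons, List.length_cons, Pi.add_apply, hi0, h0z]
      exact ⟨by omega, by omega, fun a ha => (h3 a ha).trans (Nat.le_succ _)⟩
    · simp only [List.length_cons]; omega
    · simp only [List.length_cons]; omega
    · simp only [List.length_cons, List.map_cons, List.sum_cons, Pi.add_apply, hi0, h0z]; omega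
    · intro j; simp only [List.map_cons, List.sum_cons, Pi.add_apply, h7, hw, h0s]; omega

theorem IsGood.admissible {w : List (Fin d)} {T : Term d} (h : IsGood w T) :
    Admissible 1 (wordIdx w) T.1.length (fun l => T.1.get l) T.2 where
  r_le := by rw [order_wordIdx]; exact Nat.succ_le_succ h.length_le
  ne_zero l := h.ne_zero _ (List.get_mem _ _)
  ne_single l := h.ne_single _ (List.get_mem _ _)
  zero_le l := by rw [order_wordIdx]; exact h.zero_le _ (List.get_mem _ _)
  beta_le := by rw [order_wordIdx]; exact Nat.succ_le_succ h.beta_le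
  sum_zero := by
    have := h.sum_zero
    rw [← Fin.sum_univ_fun_getElem] at this
    simpa using this
  sum_succ i := by
    have := h.sum_succ i
    rw [← Fin.sum_univ_fun_getElem] at this
    simpa using this

/-- The terms of the derivative of `ρ₀(ξ) / D⁰φ(ξ, ·)` along a word. -/
def terms (w : List (Fin d)) : List (Term d) := w.foldr (fun i L => L.flatMap (diff i)) [([], 0)]

theorem isGood_of_mem_terms {w : List (Fin d)} : ∀ T ∈ terms w, IsGood w T := by
  induction w with
  | nil =>
    intro T hT
    obtain rfl : T = ([], 0) := by simpa [terms] using hT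
    exact isGood_nil
  | cons i w ih =>
    intro T hT
    obtain ⟨S, hS, hT⟩ := List.mem_flatMap.1 hT
    exact (ih S hS).of_mem_diff hT

/-- After `k` derivatives `r ≤ 2k`, so the next one multiplies the number of terms by at most `4r +
3 ≤ 8k + 3 ≤ 8(k + 1)`. -/
theorem length_terms_le (w : List (Fin d)) :
    (terms w).length ≤ 8 ^ w.length * w.length.factorial := by
  induction w with
  | nil => simp [terms]
  | cons i w ih =>
    have e : terms (i :: w) = (terms w).flatMap (diff i) := rfl
    have h1 : ∀ n ∈ (terms w).map (fun T => (diff i T).length), n ≤ 8 * (w.length + 1) := by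
      intro n hn
      obtain ⟨T, hT, rfl⟩ := List.mem_map.1 hn
      have := (isGood_of_mem_terms T hT).length_le
      rw [length_diff]
      omega
    have h2 := List.sum_le_card_nsmul _ _ h1
    rw [List.length_map, smul_eq_mul] at h2
    rw [e, List.length_flatMap, List.length_cons, Nat.factorial_succ, pow_succ]
    calc _ ≤ (terms w).length * (8 * (w.length + 1)) := h2
      _ ≤ (8 ^ w.length * w.length.factorial) * (8 * (w.length + 1)) := Nat.mul_le_mul_right _ ih
      _ = _ := by ring

theorem hFun_get (ρ₀ : ℝ → ℝ) (φ : (Fin (d + 1) → ℝ) → ℝ) (T : Term d) (t : ℝ) (y : Fin d → ℝ)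
    (h : partialD 0 φ = mixedD (Pi.single 0 1) φ) :
    hFun ρ₀ φ 1 T.1.length (fun l => T.1.get l) T.2 t y =
      eval (fun a => mixedD a φ (pt (xi φ t y) y)) (fun k => iteratedDeriv k ρ₀ (xi φ t y)) T := by
  rw [hFun, eval, h]
  congr 2
  rw [← Fin.prod_univ_fun_getElem]
  rfl

end Term


/-! ### The preintegral and its derivatives along words -/

theorem mixedD_zero {n : ℕ} (g : (Fin n → ℝ) → ℝ) : mixedD 0 g = g := by
  have : ∀ L : List (Fin n), L.foldr (fun i f => (partialD i)^[(0 : Fin n → ℕ) i] f) g = g := by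
    intro L
    induction L with
    | nil => rfl
    | cons i L ih => rw [List.foldr_cons, ih]; rfl
  exact this _

theorem ContMixed.hasPartial {n : ℕ} {ν : Fin n → ℕ} {g : (Fin n → ℝ) → ℝ} (h : ContMixed ν g)
    {a : Fin n → ℕ} {j : Fin n} (ha : a + Pi.single j 1 ≤ ν) :
    HasPartial j (mixedD a g) (mixedD (a + Pi.single j 1) g) :=
  (h a (le_self_add.trans ha)).2 j ha

theorem hasDerivAt_list_sum {ι : Type*} {f : ι → ℝ → ℝ} {f' : ι → ℝ} {s₀ : ℝ} {l : List ι}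
    (h : ∀ T ∈ l, HasDerivAt (f T) (f' T) s₀) :
    HasDerivAt (fun s => (l.map fun T => f T s).sum) (l.map f').sum s₀ := by
  induction l with
  | nil => simpa using hasDerivAt_const s₀ (0 : ℝ)
  | cons T l ih =>
    simp only [List.map_cons, List.sum_cons]
    exact (h T List.mem_cons_self).add (ih fun S hS => h S (List.mem_cons_of_mem _ hS))

theorem order_mono {n : ℕ} {η ν : Fin n → ℕ} (h : η ≤ ν) : order η ≤ order ν :=
  Finset.sum_le_sum fun i _ => h i

section Preintegral

variable {d : ℕ}

theorem le_idx_iff {k : ℕ} {ν : Fin d → ℕ} {a : Fin (d + 1) → ℕ} :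
    a ≤ idx k ν ↔ a 0 ≤ k ∧ ∀ i : Fin d, a i.succ ≤ ν i := by
  rw [Pi.le_def, Fin.forall_fin_succ]
  rfl

theorem Term.IsGood.succ_le {w : List (Fin d)} {T : Term d} (h : T.IsGood w)
    {a : Fin (d + 1) → ℕ} (ha : a ∈ T.1) (i : Fin d) : a i.succ ≤ wordIdx w i := by
  rw [← h.sum_succ i]
  exact List.single_le_sum (fun _ _ => Nat.zero_le _) _ (List.mem_map_of_mem ha)

theorem Term.IsGood.le_idx {ν : Fin d → ℕ} {w : List (Fin d)} {T : Term d} (h : T.IsGood w)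
    (hw : wordIdx w ≤ ν) {a : Fin (d + 1) → ℕ} (ha : a ∈ T.1) : a ≤ idx (order ν + 1) ν := by
  have ho := order_mono hw
  rw [order_wordIdx] at ho
  rw [le_idx_iff]
  exact ⟨(h.zero_le a ha).trans (by omega), fun i => (h.succ_le ha i).trans (hw i)⟩

/-- The order `|ν| + 1` in `y_0` is just enough: a factor has `a 0 ≤ |w| + 1 ≤ |ν|` before the last
derivative. The denominator is covered through the index `e_0`. -/
theorem add_single_zero_le_idx {ν : Fin d → ℕ} {w : List (Fin d)} {T : Term d} (h : T.IsGood w)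
    {i : Fin d} (hw : wordIdx (i :: w) ≤ ν) {a : Fin (d + 1) → ℕ}
    (ha : a ∈ Pi.single 0 1 :: T.1) : a + Pi.single 0 1 ≤ idx (order ν + 1) ν := by
  have ho := order_mono hw
  rw [order_wordIdx, List.length_cons] at ho
  rw [le_idx_iff]
  rcases List.mem_cons.1 ha with rfl | ha
  · refine ⟨?_, fun j => ?_⟩
    · simp; omega
    · simp
  · refine ⟨?_, fun j => ?_⟩
    · have := h.zero_le a ha
      simp; omega
    · simpa using (h.succ_le ha j).trans (((wordIdx_le_cons i w).trans hw) j)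

theorem add_single_succ_le_idx {ν : Fin d → ℕ} {w : List (Fin d)} {T : Term d} (h : T.IsGood w)
    {i : Fin d} (hw : wordIdx (i :: w) ≤ ν) {a : Fin (d + 1) → ℕ}
    (ha : a ∈ Pi.single 0 1 :: T.1) : a + Pi.single i.succ 1 ≤ idx (order ν + 1) ν := by
  have ho := order_mono hw
  rw [order_wordIdx, List.length_cons] at ho
  have hle : ∀ j, a j.succ ≤ wordIdx w j := by
    intro j
    rcases List.mem_cons.1 ha with rfl | ha
    · simp
    · exact h.succ_le ha j
  have hz : a 0 ≤ w.length + 1 := by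
    rcases List.mem_cons.1 ha with rfl | ha
    · simp
    · exact h.zero_le a ha
  rw [le_idx_iff]
  refine ⟨by simp; omega, fun j => ?_⟩
  have h1 := hw j
  have h2 := hle j
  rw [wordIdx_cons, Pi.add_apply] at h1
  rw [Pi.add_apply]
  rcases eq_or_ne j i with rfl | hj
  · simp only [Pi.single_eq_same] at h1 ⊢; omega
  · have : j.succ ≠ i.succ := fun h => hj (Fin.succ_injective _ h)
    simp only [Pi.single_eq_of_ne hj, Pi.single_eq_of_ne this] at h1 ⊢; omega

namespace Smooth

variable {ρ ψ : Fin (d + 1) → ℝ → ℝ} {γ : Finset (Fin (d + 1)) → ℝ} {ν : Fin d → ℕ}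
  {φ : (Fin (d + 1) → ℝ) → ℝ}

theorem continuous_mixedD (h : Smooth ρ ψ γ ν φ) {a : Fin (d + 1) → ℕ}
    (ha : a ≤ idx (order ν + 1) ν) : Continuous (mixedD a φ) :=
  (h.cont_mixed a ha).1

theorem continuous (h : Smooth ρ ψ γ ν φ) : Continuous φ := by
  simpa [mixedD_zero] using h.continuous_mixedD (a := 0) (fun _ => Nat.zero_le _)

theorem single_zero_le (ν : Fin d → ℕ) : Pi.single 0 1 ≤ idx (order ν + 1) ν := by
  rw [le_idx_iff]
  exact ⟨by simp, by simp⟩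

theorem hasPartial_zero (h : Smooth ρ ψ γ ν φ) : HasPartial 0 φ (mixedD (Pi.single 0 1) φ) := by
  have := h.cont_mixed.hasPartial (a := 0) (j := 0) (by rw [zero_add]; exact single_zero_le ν)
  rwa [zero_add, mixedD_zero] at this

theorem partialD_zero (h : Smooth ρ ψ γ ν φ) : partialD 0 φ = mixedD (Pi.single 0 1) φ :=
  h.hasPartial_zero.eq_partialD

theorem continuous_partial_zero (h : Smooth ρ ψ γ ν φ) :
    Continuous (mixedD (Pi.single 0 1) φ) :=
  h.continuous_mixedD (single_zero_le ν)

theorem pos (h : Smooth ρ ψ γ ν φ) (x : Fin (d + 1) → ℝ) : 0 < mixedD (Pi.single 0 1) φ x := by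
  have := h.mono (x 0) (Fin.tail x)
  rwa [h.partialD_zero, pt, Fin.cons_self_tail] at this

theorem isOpen_U (h : Smooth ρ ψ γ ν φ) (t : ℝ) : IsOpen (U φ t) :=
  Preint.isOpen_U h.continuous h.hasPartial_zero h.pos

theorem continuousAt_xi (h : Smooth ρ ψ γ ν φ) {t : ℝ} {y : Fin d → ℝ} (hy : y ∈ U φ t) :
    ContinuousAt (xi φ t) y :=
  Preint.continuousAt_xi h.continuous h.hasPartial_zero h.pos hy

theorem continuous_pt_left (h : Smooth ρ ψ γ ν φ) (y : Fin d → ℝ) :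
    Continuous fun s => φ (pt s y) :=
  h.continuous.comp (continuous_pt.comp (continuous_id.prodMk continuous_const))

theorem isDiracComp_of_mem (h : Smooth ρ ψ γ ν φ) {t : ℝ} {y : Fin d → ℝ} (hy : y ∈ U φ t) :
    IsDiracComp (fun s => φ (pt s y)) t
      (ENNReal.ofReal (1 / mixedD (Pi.single 0 1) φ (pt (xi φ t y) y)) •
        Measure.dirac (xi φ t y)) :=
  isDiracComp_smul_dirac (f' := fun s => mixedD (Pi.single 0 1) φ (pt s y))
    (h.hasPartial_zero.hasDerivAt_pt y)
    (h.continuous_partial_zero.comp (continuous_pt.comp (continuous_id.prodMk continuous_const)))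
    (fun _ => h.pos _) (apply_xi hy)

theorem isDiracComp_of_notMem (h : Smooth ρ ψ γ ν φ) {t : ℝ} {y : Fin d → ℝ} (hy : y ∉ U φ t) :
    IsDiracComp (fun s => φ (pt s y)) t 0 :=
  isDiracComp_zero (h.continuous_pt_left y) (h.growth y) fun s hs => hy ⟨s, hs⟩

theorem isDiracComp_diracComp (h : Smooth ρ ψ γ ν φ) (t : ℝ) (y : Fin d → ℝ) :
    IsDiracComp (fun s => φ (pt s y)) t (diracComp (fun s => φ (pt s y)) t) := by
  by_cases hy : y ∈ U φ t
  · exact (h.isDiracComp_of_mem hy).isDiracComp_diracComp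
  · exact (h.isDiracComp_of_notMem hy).isDiracComp_diracComp

theorem preintDirac_of_mem (h : Smooth ρ ψ γ ν φ) (ρ₀ : ℝ → ℝ) {t : ℝ} {y : Fin d → ℝ}
    (hy : y ∈ U φ t) :
    preintDirac ρ₀ φ t y = ρ₀ (xi φ t y) / mixedD (Pi.single 0 1) φ (pt (xi φ t y) y) := by
  have := h.pos (pt (xi φ t y) y)
  rw [preintDirac, (h.isDiracComp_of_mem hy).diracComp_eq, integral_smul_measure, integral_dirac,
    ENNReal.toReal_ofReal (by positivity), smul_eq_mul]
  ring

theorem preintDirac_of_notMem (h : Smooth ρ ψ γ ν φ) (ρ₀ : ℝ → ℝ) {t : ℝ} {y : Fin d → ℝ}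
    (hy : y ∉ U φ t) : preintDirac ρ₀ φ t y = 0 := by
  rw [preintDirac, (h.isDiracComp_of_notMem hy).diracComp_eq, integral_zero_measure]

end Smooth

/-- The value of the function `h` with the parameters `T`. -/
def termFun (ρ₀ : ℝ → ℝ) (φ : (Fin (d + 1) → ℝ) → ℝ) (t : ℝ) (T : Term d) (y : Fin d → ℝ) : ℝ :=
  T.eval (fun a => mixedD a φ (pt (xi φ t y) y)) (fun k => iteratedDeriv k ρ₀ (xi φ t y))

/-- The derivative of the preintegral along a word. -/
def preintDeriv (ρ₀ : ℝ → ℝ) (φ : (Fin (d + 1) → ℝ) → ℝ) (t : ℝ) (w : List (Fin d)) :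
    (Fin d → ℝ) → ℝ :=
  (U φ t).indicator fun y => ((Term.terms w).map fun T => termFun ρ₀ φ t T y).sum

variable {ρ ψ : Fin (d + 1) → ℝ → ℝ} {γ : Finset (Fin (d + 1)) → ℝ} {ν : Fin d → ℕ}
  {φ : (Fin (d + 1) → ℝ) → ℝ} {t : ℝ}

theorem preintDirac_eq_preintDeriv (h : Smooth ρ ψ γ ν φ) (ρ₀ : ℝ → ℝ) (t : ℝ) :
    preintDirac ρ₀ φ t = preintDeriv ρ₀ φ t [] := by
  funext y
  rw [preintDeriv]
  by_cases hy : y ∈ U φ t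
  · rw [h.preintDirac_of_mem _ hy, Set.indicator_of_mem hy]
    simp [Term.terms, termFun, Term.eval]
  · rw [h.preintDirac_of_notMem _ hy, Set.indicator_of_notMem hy]

theorem Term.IsGood.continuousAt_termFun (h : Smooth ρ ψ γ ν φ) {w : List (Fin d)} {T : Term d}
    (hT : T.IsGood w) (hw : wordIdx w ≤ ν) {y : Fin d → ℝ} (hy : y ∈ U φ t) :
    ContinuousAt (termFun (ρ 0) φ t T) y := by
  have hp : ContinuousAt (fun z => pt (xi φ t z) z) y :=
    continuous_pt.continuousAt.comp ((h.continuousAt_xi hy).prodMk continuousAt_id)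
  have hA : ∀ a ≤ idx (order ν + 1) ν, ContinuousAt (fun z => mixedD a φ (pt (xi φ t z) z)) y :=
    fun a ha => (h.continuous_mixedD ha).continuousAt.comp hp
  have ho := order_mono hw
  rw [order_wordIdx] at ho
  have hR : ContinuousAt (fun z => iteratedDeriv T.2 (ρ 0) (xi φ t z)) y :=
    (h.density_smooth.continuous_iteratedDeriv _
      (by exact_mod_cast hT.beta_le.trans ho)).continuousAt.comp (h.continuousAt_xi hy)
  have hP : ContinuousAt
      (fun z => (T.1.map fun a => mixedD a φ (pt (xi φ t z) z)).prod) y :=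
    tendsto_list_prod _ fun a ha => hA a (hT.le_idx hw ha)
  exact ((continuousAt_const.mul hR).mul hP).div ((hA _ (Smooth.single_zero_le ν)).pow _)
    (pow_ne_zero _ (h.pos _).ne')

theorem Term.IsGood.hasDerivAt_termFun (h : Smooth ρ ψ γ ν φ) {w : List (Fin d)} {T : Term d}
    (hT : T.IsGood w) {i : Fin d} (hw : wordIdx (i :: w) ≤ ν) {y : Fin d → ℝ} (hy : y ∈ U φ t) :
    HasDerivAt (fun s => termFun (ρ 0) φ t T (Function.update y i s))
      ((T.diff i).map fun S => termFun (ρ 0) φ t S y).sum (y i) := by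
  have ho := order_mono hw
  rw [order_wordIdx, List.length_cons] at ho
  have h1 : HasPartial i.succ φ (mixedD (Pi.single i.succ 1) φ) := by
    have hle : (0 : Fin (d + 1) → ℕ) + Pi.single i.succ 1 ≤ idx (order ν + 1) ν :=
      (add_le_add_left (fun _ => Nat.zero_le _ : (0 : Fin (d + 1) → ℕ) ≤ Pi.single 0 1) _).trans
        (add_single_succ_le_idx hT hw (a := Pi.single 0 1) List.mem_cons_self)
    have := h.cont_mixed.hasPartial hle
    rwa [zero_add, mixedD_zero] at this
  have hx := hasDerivAt_xi h.continuous h.hasPartial_zero h.pos h.continuous_partial_zero h1 hy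
  have key := Term.hasDerivAt_eval (T := T) (i := i) (s₀ := y i)
    (A := fun s a => mixedD a φ (pt (xi φ t (Function.update y i s)) (Function.update y i s)))
    (R := fun s k => iteratedDeriv k (ρ 0) (xi φ t (Function.update y i s)))
    (h.pos _).ne' (fun a ha => ?_) ?_
  · simp only [Function.update_eq_self] at key
    exact key
  · have h0 := add_single_zero_le_idx hT hw ha
    have := (h.cont_mixed.hasPartial h0).hasDerivAt_comp
      (h.cont_mixed.hasPartial (add_single_succ_le_idx hT hw ha)) (h.continuous_mixedD h0) hx
    refine this.congr_deriv ?_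
    simp only [Function.update_eq_self]
    ring
  · have hβ : (T.2 : WithTop ℕ∞) < (order ν : ℕ) := by
      have := hT.beta_le
      exact_mod_cast (by omega : T.2 < order ν)
    have hd : HasDerivAt (iteratedDeriv T.2 (ρ 0)) (iteratedDeriv (T.2 + 1) (ρ 0) (xi φ t y))
        (xi φ t y) := by
      rw [iteratedDeriv_succ]
      exact (h.density_smooth.differentiable_iteratedDeriv T.2 hβ _).hasDerivAt
    have hd' : HasDerivAt (iteratedDeriv T.2 (ρ 0)) (iteratedDeriv (T.2 + 1) (ρ 0) (xi φ t y))
        (xi φ t (Function.update y i (y i))) := by simpa using hd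
    refine (hd'.comp (y i) hx).congr_deriv ?_
    simp only [Function.update_eq_self]
    ring

variable {a b : ℝ} {B : (Fin d → ℕ) → ℝ≥0}

/-- Boundary decay of every `h` makes all the extended sums continuous. The derivative is computed
termwise inside the open set `U_t`, and `hasPartial_of_zero_off` carries it across the boundary. -/
theorem isDerivFamily_preintDeriv (h : Smooth ρ ψ γ ν φ)
    (hB : ∀ η : Fin d → ℕ, η ≤ ν → Controlled ρ ψ φ a b 1 η (B η)) (ht : t ∈ Set.Icc a b) :
    IsDerivFamily ν (preintDeriv (ρ 0) φ t) := by
  have hc : ∀ w, wordIdx w ≤ ν → Continuous (preintDeriv (ρ 0) φ t w) := by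
    intro w hw
    refine continuous_indicator_of_tendsto_zero (h.isOpen_U t) (fun y hy => ?_) fun z hz => ?_
    · exact tendsto_list_sum _ fun T hT =>
        (Term.isGood_of_mem_terms T hT).continuousAt_termFun h hw hy
    · have := tendsto_list_sum (f := fun T y => termFun (ρ 0) φ t T y) (x := 𝓝[U φ t] z)
        (a := fun _ => 0) (Term.terms w) fun T hT => ?_
      · simpa using this
      · have := (hB _ hw _ _ _ (Term.isGood_of_mem_terms T hT).admissible).1 t ht z hz
        refine this.congr fun y => ?_
        rw [Term.hFun_get _ _ _ _ _ h.partialD_zero]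
        rfl
  refine ⟨hc, fun i w hw => ?_⟩
  have hw' := (wordIdx_le_cons i w).trans hw
  refine hasPartial_of_zero_off (h.isOpen_U t) (hc w hw') (hc _ hw)
    (fun y hy => Set.indicator_of_notMem hy _) (fun y hy => Set.indicator_of_notMem hy _)
    fun y hy => ?_
  have hu : Continuous fun s : ℝ => Function.update y i s := continuous_const.update i continuous_id
  have hUe : ∀ᶠ s in 𝓝 (y i), Function.update y i s ∈ U φ t :=
    hu.continuousAt.eventually_mem (by simpa using (h.isOpen_U t).mem_nhds hy)
  have hd := hasDerivAt_list_sum (f := fun T s => termFun (ρ 0) φ t T (Function.update y i s))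
    fun T hT => (Term.isGood_of_mem_terms T hT).hasDerivAt_termFun h hw hy
  refine (hd.congr_of_eventuallyEq ?_).congr_deriv ?_
  · filter_upwards [hUe] with s hs
    rw [preintDeriv, Set.indicator_of_mem hs]
  · rw [preintDeriv, Set.indicator_of_mem hy]
    have e : Term.terms (i :: w) = (Term.terms w).flatMap (Term.diff i) := rfl
    rw [e, List.map_flatMap, List.flatMap_def, List.sum_flatten, List.map_map]
    rfl

/-! ### The Sobolev norm -/

theorem IsSetting.weight_nonneg (hset : IsSetting ρ ψ γ) (η : Fin d → ℕ) (y : Fin d → ℝ) :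
    0 ≤ weight (tailFam ρ) (tailFam ψ) η y :=
  mul_nonneg (Finset.prod_nonneg fun _ _ => (hset.weight_pos _ _).le)
    (Finset.prod_nonneg fun _ _ => hset.density_nonneg _ _)

theorem IsSetting.aemeasurable_weight (hset : IsSetting ρ ψ γ) (η : Fin d → ℕ) :
    AEMeasurable (weight (tailFam ρ) (tailFam ψ) η) volume := by
  refine AEMeasurable.mul ?_ ?_
  · refine Finset.aemeasurable_fun_prod _ fun i _ => ?_
    -- `ψ_i` is only almost everywhere measurable, so composing with a coordinate needs that
    -- preimages of null sets are null.
    exact (hset.weight_integrable i.succ).aemeasurable.comp_quasiMeasurePreserving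
      (Measure.quasiMeasurePreserving_eval (fun _ => volume) i)
  · refine Finset.aemeasurable_fun_prod _ fun i _ => ?_
    exact ((hset.density_measurable i.succ).comp (measurable_pi_apply i)).aemeasurable

theorem ofReal_abs_sum_sq_mul_le {ι : Type*} [Fintype ι] (f : ι → ℝ) {c : ℝ} (hc : 0 ≤ c) :
    ENNReal.ofReal (|∑ k, f k| ^ 2 * c) ≤
      ∑ k, Fintype.card ι * ENNReal.ofReal (|f k| ^ 2 * c) := by
  have h1 : |∑ k, f k| ^ 2 * c ≤ ∑ k, Fintype.card ι * (|f k| ^ 2 * c) := by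
    rw [← Finset.mul_sum, ← Finset.sum_mul, ← mul_assoc]
    refine mul_le_mul_of_nonneg_right ?_ hc
    simp only [sq_abs]
    exact sq_sum_le_card_mul_sum_sq
  refine (ENNReal.ofReal_le_ofReal h1).trans ?_
  rw [ENNReal.ofReal_sum_of_nonneg fun k _ => by positivity]
  refine Finset.sum_le_sum fun k _ => ?_
  rw [ENNReal.ofReal_mul (by positivity), ENNReal.ofReal_natCast]

theorem energy_preintDirac_le (hset : IsSetting ρ ψ γ) (h : Smooth ρ ψ γ ν φ)
    (hB : ∀ η : Fin d → ℕ, η ≤ ν → Controlled ρ ψ φ a b 1 η (B η)) (ht : t ∈ Set.Icc a b)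
    {η : Fin d → ℕ} (hη : η ≤ ν) :
    energy (tailFam ρ) (tailFam ψ) η (preintDirac (ρ 0) φ t) ≤
      ENNReal.ofReal (((8 : ℝ) ^ order η * (order η).factorial) ^ 2 * B η) := by
  have hG := isDerivFamily_preintDeriv h hB ht
  rw [preintDirac_eq_preintDeriv h]
  -- The energy is an infimum over weak derivatives, so the classical derivative alone gives an
  -- upper bound.
  refine (iInf₂_le _ (hG.isWeakDeriv hη)).trans ?_
  obtain ⟨w, rfl⟩ : ∃ w, η = wordIdx w := ⟨word η, (wordIdx_word η).symm⟩
  have hw' : wordIdx (word (wordIdx w)) ≤ ν := by rwa [wordIdx_word]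
  rw [hG.eq_of_perm (perm_of_wordIdx_eq (wordIdx_word (wordIdx w))) hw']
  set m := (Term.terms w).length with hm
  have hUm : MeasurableSet (U φ t) := (h.isOpen_U t).measurableSet
  have e1 : ∀ y, ENNReal.ofReal (|preintDeriv (ρ 0) φ t w y| ^ 2 *
      weight (tailFam ρ) (tailFam ψ) (wordIdx w) y) = (U φ t).indicator (fun y =>
        ENNReal.ofReal (|∑ k : Fin m, termFun (ρ 0) φ t ((Term.terms w)[k]) y| ^ 2 *
          weight (tailFam ρ) (tailFam ψ) (wordIdx w) y)) y := by
    intro y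
    by_cases hy : y ∈ U φ t
    · rw [preintDeriv, Set.indicator_of_mem hy, Set.indicator_of_mem hy,
        ← Fin.sum_univ_fun_getElem]
      rfl
    · rw [preintDeriv, Set.indicator_of_notMem hy, Set.indicator_of_notMem hy]
      simp
  rw [lintegral_congr e1, lintegral_indicator hUm]
  set F : Fin m → (Fin d → ℝ) → ℝ≥0∞ := fun k y => ENNReal.ofReal
    (|termFun (ρ 0) φ t ((Term.terms w)[k]) y| ^ 2 *
      weight (tailFam ρ) (tailFam ψ) (wordIdx w) y) with hF
  have hbound : ∀ k, ∫⁻ y in U φ t, F k y ≤ B (wordIdx w) := by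
    intro k
    have hT := Term.isGood_of_mem_terms _ (List.getElem_mem k.2 : (Term.terms w)[k] ∈ Term.terms w)
    have h2 := (hB _ hη _ _ _ hT.admissible).2
    refine le_trans (le_of_eq ?_) ((le_iSup₂ (f := fun t (_ : t ∈ Set.Icc a b) => _) t ht).trans h2)
    refine lintegral_congr fun y => ?_
    rw [Term.hFun_get _ _ _ _ _ h.partialD_zero]
    rfl
  have hmeas : ∀ k, AEMeasurable (fun y => (Fintype.card (Fin m) : ℝ≥0∞) * F k y)
      (volume.restrict (U φ t)) := by
    intro k
    have hT := Term.isGood_of_mem_terms _ (List.getElem_mem k.2 : (Term.terms w)[k] ∈ Term.terms w)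
    have hc : ContinuousOn (termFun (ρ 0) φ t ((Term.terms w)[k])) (U φ t) := fun y hy =>
      (hT.continuousAt_termFun h hη hy).continuousWithinAt
    exact (((hc.abs.pow 2).aemeasurable hUm).mul
      (hset.aemeasurable_weight _).restrict).ennreal_ofReal.const_mul _
  have hm' : (m : ℝ) ≤ 8 ^ order (wordIdx w) * (order (wordIdx w)).factorial := by
    rw [order_wordIdx]
    exact_mod_cast Term.length_terms_le w
  -- Cauchy–Schwarz costs a factor `m` and the sum over `m` terms another, giving `m² B` with `m ≤
  -- 8^|η| |η|!`.
  calc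
    _ ≤ ∫⁻ y in U φ t, ∑ k : Fin m, (Fintype.card (Fin m) : ℝ≥0∞) * F k y :=
        lintegral_mono fun y => ofReal_abs_sum_sq_mul_le _ (hset.weight_nonneg _ y)
    _ = ∑ k : Fin m, (Fintype.card (Fin m) : ℝ≥0∞) * ∫⁻ y in U φ t, F k y := by
        rw [lintegral_finsetSum' _ fun k _ => hmeas k]
        exact Finset.sum_congr rfl fun k _ =>
          lintegral_const_mul' _ _ (ENNReal.natCast_ne_top _)
    _ ≤ ∑ k : Fin m, (Fintype.card (Fin m) : ℝ≥0∞) * B (wordIdx w) :=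
        Finset.sum_le_sum fun k _ => mul_le_mul_right (hbound k) _
    _ = ENNReal.ofReal ((m : ℝ) ^ 2 * B (wordIdx w)) := by
        rw [Finset.sum_const, Finset.card_univ, Fintype.card_fin, nsmul_eq_mul,
          ENNReal.ofReal_mul (by positivity), ENNReal.ofReal_coe_nnreal,
          ENNReal.ofReal_pow (by positivity), ENNReal.ofReal_natCast]
        ring
    _ ≤ _ := by
        refine ENNReal.ofReal_le_ofReal ?_
        gcongr

theorem sobolevNorm_preintDirac_le (hset : IsSetting ρ ψ γ) (h : Smooth ρ ψ γ ν φ)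
    (hB : ∀ η : Fin d → ℕ, η ≤ ν → Controlled ρ ψ φ a b 1 η (B η)) (ht : t ∈ Set.Icc a b) :
    sobolevNorm (tailFam ρ) (tailFam ψ) (tailParam γ) ν (preintDirac (ρ 0) φ t) ≤
      ENNReal.ofReal (Real.sqrt (∑ η ∈ Finset.Iic ν,
        ((8 : ℝ) ^ order η * (order η).factorial) ^ 2 * (B η : ℝ) / tailParam γ (supp η))) := by
  have hγ : ∀ u, 0 < tailParam γ u := fun u => hset.param_pos _
  have hnn : ∀ η : Fin d → ℕ,
      0 ≤ ((8 : ℝ) ^ order η * (order η).factorial) ^ 2 * (B η : ℝ) / tailParam γ (supp η) :=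
    fun η => div_nonneg (by positivity) (hγ _).le
  rw [sobolevNorm, Real.sqrt_eq_rpow,
    ← ENNReal.ofReal_rpow_of_nonneg (Finset.sum_nonneg fun η _ => hnn η) (by norm_num)]
  refine ENNReal.rpow_le_rpow ?_ (by norm_num)
  rw [ENNReal.ofReal_sum_of_nonneg fun η _ => hnn η]
  refine Finset.sum_le_sum fun η hη => ?_
  have e : ((8 : ℝ) ^ order η * (order η).factorial) ^ 2 * (B η : ℝ) / tailParam γ (supp η) =
      1 / tailParam γ (supp η) * (((8 : ℝ) ^ order η * (order η).factorial) ^ 2 * (B η : ℝ)) := by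
    ring
  rw [e, ENNReal.ofReal_mul (one_div_nonneg.2 (hγ _).le)]
  exact mul_le_mul_right (energy_preintDirac_le hset h hB ht (Finset.mem_Iic.1 hη)) _

end Preintegral

end Preint

/-! ### The main theorem -/

theorem theorem4 {d : ℕ} (hd : 1 ≤ d) (ν : Fin d → ℕ) (a b : ℝ) (hab : a ≤ b)
    (ρ ψ : Fin (d + 1) → ℝ → ℝ) (γ : Finset (Fin (d + 1)) → ℝ)
    (hset : Preint.IsSetting ρ ψ γ)
    (φ : (Fin (d + 1) → ℝ) → ℝ)
    (hφ : Preint.Smooth ρ ψ γ ν φ)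
    (B : (Fin d → ℕ) → ℝ≥0)
    (hB : ∀ η : Fin d → ℕ, η ≤ ν → Preint.Controlled ρ ψ φ a b 1 η (B η)) :
    (∀ t ∈ Set.Icc a b,
      (∀ y : Fin d → ℝ, Preint.IsDiracComp (fun s => φ (Preint.pt s y)) t
        (Preint.diracComp (fun s => φ (Preint.pt s y)) t)) ∧
      (∀ y ∈ Preint.U φ t, Preint.preintDirac (ρ 0) φ t y =
        ρ 0 (Preint.xi φ t y) /
          Preint.partialD 0 φ (Preint.pt (Preint.xi φ t y) y)) ∧
      (∀ y ∉ Preint.U φ t, Preint.preintDirac (ρ 0) φ t y = 0) ∧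
      Preint.MemSobolev (Preint.tailFam ρ) (Preint.tailFam ψ) (Preint.tailParam γ) ν
        (Preint.preintDirac (ρ 0) φ t) ∧
      Preint.ContMixed ν (Preint.preintDirac (ρ 0) φ t)) ∧
    (⨆ t ∈ Set.Icc a b,
      Preint.sobolevNorm (Preint.tailFam ρ) (Preint.tailFam ψ) (Preint.tailParam γ) ν
        (Preint.preintDirac (ρ 0) φ t)) ≤
      ENNReal.ofReal (Real.sqrt (∑ η ∈ Finset.Iic ν,
        ((8 : ℝ) ^ Preint.order η * (Preint.order η).factorial) ^ 2 * (B η : ℝ) /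
          Preint.tailParam γ (Preint.supp η))) := by
  have hone : ∀ t ∈ Set.Icc a b, Preint.sobolevNorm (Preint.tailFam ρ) (Preint.tailFam ψ)
      (Preint.tailParam γ) ν (Preint.preintDirac (ρ 0) φ t) ≤ _ :=
    fun t ht => Preint.sobolevNorm_preintDirac_le hset hφ hB ht
  refine ⟨fun t ht => ?_, iSup₂_le hone⟩
  have hG := Preint.isDerivFamily_preintDeriv hφ hB ht
  have hcm : Preint.ContMixed ν (Preint.preintDirac (ρ 0) φ t) := by
    rw [Preint.preintDirac_eq_preintDeriv hφ]
    exact hG.contMixed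
  have hc : Continuous (Preint.preintDirac (ρ 0) φ t) := by
    rw [Preint.preintDirac_eq_preintDeriv hφ]
    exact hG.continuous [] fun _ => Nat.zero_le _
  refine ⟨hφ.isDiracComp_diracComp t, fun y hy => ?_, fun y hy => hφ.preintDirac_of_notMem _ hy,
    ⟨hc.locallyIntegrable, (hone t ht).trans_lt ENNReal.ofReal_lt_top⟩, hcm⟩
  rw [hφ.preintDirac_of_mem _ hy, hφ.partialD_zero]

end
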